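/- Let $q\ge 2$, let $T=T_{q+1}$ be the $(q+1)$-regular tree, and let $v_0$ be a vertex of $T$. Let $\Gamma=\Gamma(T,v_0)$ be the dynamic graph (pascalization) of $T$: the $\mathbb N$-graded graph whose $n$th level is a copy of the set of vertices of $T$ that are joined with $v_0$ by walks of length $n$, two vertices of consecutive levels being adjacent if and only if their copies are adjacent in $T$. Let $T(\Gamma)$ be the compact space of infinite paths $x=(x_0,x_1,\dots)$ in $\Gamma$ that start at the unique vertex of level $0$. A Borel probability measure on $T(\Gamma)$ is called central if it is a Markov measure (for every vertex $v$ of every level $n$, past and future are conditionally independent given $x_n=v$) and, for every vertex $v$ of positive measure, the conditional measure that it induces on the finite set of paths from the initial vertex to $v$ is uniform. A measure is called ergodic if the tail $\sigma$-algebra (of all Borel sets $A$ such that every path that eventually coincides with a path from $A$ belongs to $A$) consists of sets of measure $0$ or $1$ only. The absolute boundary $\operatorname{Erg}(\Gamma)$ is the set of all ergodic central measures, with the weak topology. Let $\partial T$ be the boundary of the tree, i.e. the set of infinite rays without repeated vertices starting at $v_0$, where the rays with a common given initial segment form the basic open sets. For $\omega\in\partial T$ and $r\in[0,1]$, let $\lambda_{\omega,r}$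 be the Markov measure on $T(\Gamma)$ that is the law of the random walk on $T$ starting at $v_0$ which at every step moves along the unique edge leading from the current vertex towards $\omega$ with probability $r$, and along each of the other $q$ edges with probability $(1-r)/q$ (this measure exists and is unique). Then $$\operatorname{Erg}(\Gamma)=\{\lambda_{\omega,r}\mid \omega\in\partial T,\ r\in[1/2,1]\},$$ and the map $(\omega,r)\mapsto\lambda_{\omega,r}$ is a homeomorphism of $\partial T\times[1/2,1]$ onto $\operatorname{Erg}(\Gamma)$. For every $\omega\in\partial T$ and $r\in[0,1/2)$, the measure $\lambda_{\omega,r}$ is central but not ergodic. -/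

import Mathlib

open MeasureTheory ProbabilityTheory Filter Topology
open scoped ENNReal

universe u

/-- A locally finite `ℕ`-graded graph (Bratteli diagram) with simple edges: finite levels, a single
vertex of level `0`, and edges between consecutive levels only. -/
structure GradedGraph where
  /-- the set of vertices of each level -/
  level : ℕ → Type u
  finite_level : ∀ n, Finite (level n)
  /-- the initial vertex `∅` -/
  root : level 0
  eq_root : ∀ v : level 0, v = root
  /-- `Adj u v` : there is an edge from `u` (of level `n`) to `v` (of level `n + 1`) -/
  Adj : ∀ {n : ℕ}, level n → level (n + 1) → Prop

namespace GradedGraph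

variable (Γ : GradedGraph.{u})

instance instFiniteLevel (n : ℕ) : Finite (Γ.level n) := Γ.finite_level n

/-- The levels are finite discrete spaces. -/
instance instTopologicalSpaceLevel (n : ℕ) : TopologicalSpace (Γ.level n) := ⊥

instance instDiscreteTopologyLevel (n : ℕ) : DiscreteTopology (Γ.level n) := ⟨rfl⟩

instance instMeasurableSpaceLevel (n : ℕ) : MeasurableSpace (Γ.level n) := ⊤

instance instDiscreteMeasurableSpaceLevel (n : ℕ) : DiscreteMeasurableSpace (Γ.level n) :=
  ⟨fun _ => trivial⟩

/-- The space `T(Γ)` of infinite paths starting at the initial vertex. -/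
def Path : Type u :=
  {x : ∀ n, Γ.level n // ∀ n, Γ.Adj (x n) (x (n + 1))}

/-- The topology of `T(Γ)`: a base consists of the cylinder sets. -/
instance instTopologicalSpacePath : TopologicalSpace Γ.Path :=
  inferInstanceAs (TopologicalSpace {x : ∀ n, Γ.level n // ∀ n, Γ.Adj (x n) (x (n + 1))})

instance instMeasurableSpacePath : MeasurableSpace Γ.Path :=
  inferInstanceAs (MeasurableSpace {x : ∀ n, Γ.level n // ∀ n, Γ.Adj (x n) (x (n + 1))})

/-- The `σ`-algebra of `T(Γ)` is the Borel `σ`-algebra. -/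
instance instBorelSpacePath : BorelSpace Γ.Path :=
  inferInstanceAs (BorelSpace {x : ∀ n, Γ.level n // ∀ n, Γ.Adj (x n) (x (n + 1))})

/-- Finite paths of length `n` from the initial vertex to vertices of level `n`. -/
def FinPath (n : ℕ) : Type u :=
  {p : ∀ k, k ≤ n → Γ.level k //
    ∀ k (h : k + 1 ≤ n), Γ.Adj (p k (Nat.le_of_succ_le h)) (p (k + 1) h)}

variable {Γ}

/-- The last vertex of a finite path. -/
def FinPath.last {n : ℕ} (p : Γ.FinPath n) : Γ.level n := p.1 n le_rfl

/-- The set of infinite paths with a given initial segment. -/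
def cylinder {n : ℕ} (p : Γ.FinPath n) : Set Γ.Path :=
  {x | ∀ k (h : k ≤ n), x.1 k = p.1 k h}

/-- The set of infinite paths that pass through a given vertex. -/
def through {n : ℕ} (v : Γ.level n) : Set Γ.Path := {x | x.1 n = v}

/-- The number `dim v` of paths from the initial vertex to `v`. -/
noncomputable def dim {n : ℕ} (v : Γ.level n) : ℕ := Nat.card {p : Γ.FinPath n // p.last = v}

/-- `μ` is a Markov measure: for every vertex `v` of level `n`, under the condition `x_n = v` the
past `(x_k)_{k < n}` and the future `(x_k)_{k > n}` are independent. -/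
def IsMarkov (μ : ProbabilityMeasure Γ.Path) : Prop :=
  ∀ (n : ℕ) (v : Γ.level n),
    IndepFun (fun (x : Γ.Path) (k : Set.Iio n) => x.1 (k : ℕ))
      (fun (x : Γ.Path) (k : Set.Ioi n) => x.1 (k : ℕ))
      (ProbabilityTheory.cond (μ : Measure Γ.Path) (through v))

/-- `μ` is a central measure: it is Markov, and for every vertex `v` (that is passed with positive
probability) the conditional measure on the finite set of all finite paths joining the initial
vertex with `v` is the uniform measure. -/
def IsCentral (μ : ProbabilityMeasure Γ.Path) : Prop :=
  IsMarkov μ ∧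
    ∀ (n : ℕ) (v : Γ.level n), (μ : Measure Γ.Path) (through v) ≠ 0 →
      ∀ p : Γ.FinPath n, p.last = v →
        ProbabilityTheory.cond (μ : Measure Γ.Path) (through v) (cylinder p) = (dim v : ℝ≥0∞)⁻¹

variable (Γ) in
/-- The `n`th `σ`-algebra of the tail filtration: it consists of all Borel sets that contain along
with every path all paths coinciding with it from the `n`th level on. -/
@[reducible]
def tailAlgebra (n : ℕ) : MeasurableSpace Γ.Path where
  MeasurableSet' A := MeasurableSet A ∧
    ∀ x y : Γ.Path, (∀ k, n ≤ k → x.1 k = y.1 k) → x ∈ A → y ∈ A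
  measurableSet_empty := ⟨MeasurableSet.empty, fun _ _ _ h => h⟩
  measurableSet_compl A hA :=
    ⟨hA.1.compl, fun x y h hx hy => hx (hA.2 y x (fun k hk => (h k hk).symm) hy)⟩
  measurableSet_iUnion f hf :=
    ⟨MeasurableSet.iUnion fun i => (hf i).1, fun x y h hx => by
      obtain ⟨i, hi⟩ := Set.mem_iUnion.1 hx
      exact Set.mem_iUnion.2 ⟨i, (hf i).2 x y h hi⟩⟩

/-- `μ` is ergodic: the tail `σ`-algebra, i.e. the intersection of the `σ`-algebras of the tail
filtration, is trivial mod `0`. -/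
def IsErgodic (μ : ProbabilityMeasure Γ.Path) : Prop :=
  ∀ A : Set Γ.Path, MeasurableSet[⨅ n, Γ.tailAlgebra n] A →
    (μ : Measure Γ.Path) A = 0 ∨ (μ : Measure Γ.Path) A = 1

variable (Γ) in
/-- The absolute boundary `Erg(Γ)`: the set of ergodic central measures (with the weak topology
of `ProbabilityMeasure`). -/
def erg : Set (ProbabilityMeasure Γ.Path) := {μ | IsCentral μ ∧ IsErgodic μ}

/-- `μ` is the law of the Markov chain that starts at the initial vertex and passes from
`u` (of level `n`) to `v` (of level `n + 1`) along an edge with probability `P n u v`: the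
probability of every finite path is the product of the transition probabilities along it. -/
def HasTransitions (P : ∀ n, Γ.level n → Γ.level (n + 1) → ℝ) (μ : ProbabilityMeasure Γ.Path) :
    Prop :=
  ∀ (n : ℕ) (p : Γ.FinPath n), (μ : Measure Γ.Path).real (cylinder p) =
    ∏ k : Fin n, P k (p.1 k k.2.le) (p.1 (k + 1) k.2)

end GradedGraph

namespace SimpleGraph

variable {V : Type u} (G : SimpleGraph V)

theorem finite_walk_length [G.LocallyFinite] (v₀ : V) (n : ℕ) :
    {v : V | ∃ p : G.Walk v₀ v, p.length = n}.Finite := by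
  induction n generalizing v₀ with
  | zero =>
    refine (Set.finite_singleton v₀).subset ?_
    rintro v ⟨p, hp⟩
    exact (p.eq_of_length_eq_zero hp).symm
  | succ n ih =>
    refine (Set.Finite.biUnion (Set.toFinite (G.neighborSet v₀)) fun w _ => ih w).subset ?_
    rintro v ⟨p, hp⟩
    cases p with
    | nil => simp at hp
    | cons h p => exact Set.mem_biUnion h ⟨p, by simpa using hp⟩

/-- The dynamic graph (pascalization) of a locally finite graph with a distinguished vertex `v₀`:
the `n`th level is a copy of the set of vertices connected with `v₀` by walks of length `n`, and
two vertices of adjacent levels are adjacent iff their copies are adjacent in the given graph. -/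
def pascalization [G.LocallyFinite] (v₀ : V) : GradedGraph.{u} where
  level n := {v : V // ∃ p : G.Walk v₀ v, p.length = n}
  finite_level n := (G.finite_walk_length v₀ n).to_subtype
  root := ⟨v₀, Walk.nil, rfl⟩
  eq_root v := Subtype.ext (by
    obtain ⟨v, p, hp⟩ := v
    exact (p.eq_of_length_eq_zero hp).symm)
  Adj v w := G.Adj v.1 w.1

/-- The vertex of the given graph of which a vertex of the dynamic graph is a copy. -/
def pascalizationVertex [G.LocallyFinite] {v₀ : V} {n : ℕ} (v : (G.pascalization v₀).level n) : V :=
  Subtype.val (p := fun v : V => ∃ p : G.Walk v₀ v, p.length = n) v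

/-- The boundary `∂T` of a tree: the set of infinite rays without repetition of vertices that
start at a base vertex `v₀` (each end of a tree contains exactly one of them). -/
def TreeBoundary (v₀ : V) : Type u :=
  {ω : ℕ → V // ω 0 = v₀ ∧ (∀ n, G.Adj (ω n) (ω (n + 1))) ∧ Function.Injective ω}

/-- The topology of `∂T`: a base consists of the sets of all rays with a given initial segment,
i.e. the topology is induced from the product of discrete topologies. -/
instance instTopologicalSpaceTreeBoundary (v₀ : V) : TopologicalSpace (G.TreeBoundary v₀) :=
  TopologicalSpace.induced (fun ω => ω.1) (@Pi.topologicalSpace ℕ (fun _ => V) (fun _ => ⊥))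

variable {G}

/-- The edge from `v` to `w` leads towards the boundary point `ω`: the vertex `w` is closer by one
than `v` to all sufficiently remote vertices of the ray `ω`. -/
def LeadsTowards {v₀ : V} (ω : G.TreeBoundary v₀) (v w : V) : Prop :=
  ∀ᶠ n in atTop, G.dist v (ω.1 n) = G.dist w (ω.1 n) + 1

open Classical in
/-- The transition probabilities on the `(q + 1)`-regular tree of the random walk with parameters
`ω` and `r`: the unique edge at `v` that leads towards `ω` has probability `r`, and each of the
other `q` edges has probability `(1 - r) / q`. -/
noncomputable def stepProb (q : ℕ) {v₀ : V} (ω : G.TreeBoundary v₀) (r : ℝ) (v w : V) : ℝ :=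
  if LeadsTowards ω v w then r else (1 - r) / q

/-- `μ` is the Markov measure `λ_{ω,r}` on the path space of the dynamic graph of the
`(q + 1)`-regular tree. -/
def IsLambda [G.LocallyFinite] (q : ℕ) {v₀ : V} (ω : G.TreeBoundary v₀) (r : ℝ)
    (μ : ProbabilityMeasure (G.pascalization v₀).Path) : Prop :=
  GradedGraph.HasTransitions
    (fun _ v w => stepProb q ω r (G.pascalizationVertex v) (G.pascalizationVertex w)) μ

end SimpleGraph

/-! ### Distances, regularity and ends in a tree. -/

namespace SimpleGraph

variable {V : Type u} {G : SimpleGraph V}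

/-! A measure on paths is central exactly when the mass of an initial segment depends only on its
length `n` and endpoint `v` (`IsInv`). Writing `φ(n,v)` for this mass, a central measure is a
nonnegative function with `φ(n,v) = ∑_{w ~ v} φ(n+1,w)`. For `λ_{ω,r}` the mass is `r^t
((1-r)/q)^s`, where `t` and `s` count the steps towards and away from `ω`; since `t + s = n` and `t
- s` is the change of a Busemann function, `λ_{ω,r}` is central for every `r`.

Ergodicity implies extremality (`IsInv.eq_mul_segMass`): if `0 ≤ g ≤ φ` is harmonic, then `g/φ`
along the path is a bounded martingale, whose limit is tail measurable and hence constant, so `g` is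
proportional to `φ`. Applied to the shift by two levels, this gives `φ(n+2,v) = c φ(n,v)`. If `c =
0`, almost every path is geodesic, and ergodicity makes it a single ray: this is `λ_{ω,1}`. If `c >
0`, then `φ(n,v) = s^n ψ(v)` with `s = √c`, where `ψ` is a positive eigenfunction of the adjacency
operator with eigenvalue `l = 1/s`. A Harnack inequality `F ψ(u) ≤ ψ(v)` holds across edges, `F`
being the smaller root of `qF² - lF + 1`. Cutting `ψ` at an edge produces a smaller eigenfunction,
so by extremality `ψ` changes by exactly `F` or `1/F` along every edge. Hence `ψ` increases towards
a single end `ω`, and the measure is `λ_{ω,r}` with `r = s/F = 1/(1 + qF²) ≥ 1/2`.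

Conversely, for `1/2 ≤ r < 1` a tail event gives a bounded space-time harmonic function of the walk,
and these are constant (`IsStepHarm.eq_const`); so `μ(A) = μ(A)²`. For `r = 1` the measure is a
point mass. Since the first step determines `r`, no `λ_{ω,r}` with `r < 1/2` occurs in the
classification, so none is ergodic. Finally, `(ω,r) ↦ λ_{ω,r}` is a continuous bijection from a
compact space onto a Hausdorff one. -/

/-- Each neighbour prolongs to a geodesic from `v` to `b`; geodesics are paths, and paths in a tree
are unique. -/
theorem IsTree.eq_of_adj_of_dist_eq_add_one (hT : G.IsTree) {v w w' b : V} (h : G.Adj v w)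
    (h' : G.Adj v w') (hd : G.dist v b = G.dist w b + 1) (hd' : G.dist v b = G.dist w' b + 1) :
    w = w' := by
  obtain ⟨p, hp⟩ := hT.connected.exists_walk_length_eq_dist w b
  obtain ⟨p', hp'⟩ := hT.connected.exists_walk_length_eq_dist w' b
  have h1 := (Walk.cons h p).isPath_of_length_eq_dist (by simp [hp, hd])
  have h2 := (Walk.cons h' p').isPath_of_length_eq_dist (by simp [hp', hd'])
  have := hT.isAcyclic.subsingleton_path v b |>.elim ⟨_, h1⟩ ⟨_, h2⟩
  have := congrArg (fun r : G.Path v b => r.1.snd) this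
  simpa using this

theorem IsTree.dist_adj_cases (hT : G.IsTree) {v w : V} (h : G.Adj v w) (b : V) :
    G.dist v b = G.dist w b + 1 ∨ G.dist w b = G.dist v b + 1 := by
  rw [dist_comm (u := v), dist_comm (u := w)]
  exact hT.dist_eq_dist_add_one_of_adj b h

theorem IsTree.exists_adj_dist_eq_add_one (hT : G.IsTree) {v b : V} (h : v ≠ b) :
    ∃ w, G.Adj v w ∧ G.dist v b = G.dist w b + 1 := by
  obtain ⟨p, hp⟩ := hT.connected.exists_walk_length_eq_dist v b
  cases p with
  | nil => exact absurd rfl h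
  | @cons _ w _ hvw p =>
    refine ⟨w, hvw, ?_⟩
    have h1 := dist_le p
    have h2 := hT.dist_adj_cases hvw b
    simp only [Walk.length_cons] at hp
    omega

/-- The only edge between the two branches obtained by removing an edge is that edge. -/
theorem IsTree.eq_and_eq_of_adj_of_dist_eq_add_one (hT : G.IsTree) {a b v w : V} (hab : G.Adj a b)
    (hvw : G.Adj v w) (hv : G.dist v a = G.dist v b + 1) (hw : G.dist w b = G.dist w a + 1) :
    v = b ∧ w = a := by
  have h1 := hT.dist_adj_cases hvw a
  have h2 := hT.dist_adj_cases hvw b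
  have hwb : w = a := by
    -- Otherwise the neighbour of `w` nearer to `a` is also nearer to `b`. So is `v`, hence the two
    -- coincide, but `v` is farther from `a` than `w`.
    by_contra hne
    obtain ⟨w', hw', hd⟩ := hT.exists_adj_dist_eq_add_one hne
    have h3 := hT.dist_adj_cases hw' b
    have h4 : G.dist w' b ≤ G.dist w' a + G.dist a b := hT.connected.dist_triangle
    rw [dist_eq_one_iff_adj.2 hab] at h4
    have := hT.eq_of_adj_of_dist_eq_add_one hw' hvw.symm (b := b) (by omega) (by omega)
    subst this
    omega
  subst hwb
  refine ⟨?_, rfl⟩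
  rw [dist_self] at hw h1
  exact (hT.connected.dist_eq_zero_iff).1 (by omega)

section Neighbors

variable [G.LocallyFinite] {q : ℕ}

theorem IsRegularOfDegree.sum_neighborFinset (hreg : G.IsRegularOfDegree (q + 1)) {v w : V}
    (hvw : G.Adj v w) {f : V → ℝ} {y : ℝ} (hy : ∀ u, G.Adj v u → u ≠ w → f u = y) :
    ∑ u ∈ G.neighborFinset v, f u = f w + q * y := by
  classical
  have hw : w ∈ G.neighborFinset v := by simpa using hvw
  rw [← Finset.add_sum_erase _ _ hw, Finset.sum_congr rfl
    (g := fun _ => y) fun u hu => hy u (by simpa using (Finset.mem_erase.1 hu).2)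
      (Finset.mem_erase.1 hu).1]
  rw [Finset.sum_const, Finset.card_erase_of_mem hw, card_neighborFinset_eq_degree, hreg v]
  simp

theorem IsRegularOfDegree.sum_neighborFinset_const (hreg : G.IsRegularOfDegree (q + 1)) (v : V)
    {f : V → ℝ} {y : ℝ} (hy : ∀ u, G.Adj v u → f u = y) :
    ∑ u ∈ G.neighborFinset v, f u = (q + 1) * y := by
  rw [Finset.sum_congr rfl (g := fun _ => y) fun u hu => hy u (by simpa using hu),
    Finset.sum_const, card_neighborFinset_eq_degree, hreg v]
  simp

theorem IsRegularOfDegree.exists_adj (hreg : G.IsRegularOfDegree (q + 1)) (v : V) :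
    ∃ w, G.Adj v w := by
  have : 0 < (G.neighborFinset v).card := by
    rw [card_neighborFinset_eq_degree, hreg v]; omega
  obtain ⟨w, hw⟩ := Finset.card_pos.1 this
  exact ⟨w, by simpa using hw⟩

theorem IsRegularOfDegree.exists_adj_ne_ne (hreg : G.IsRegularOfDegree (q + 1)) (hq : 2 ≤ q)
    (v u u' : V) : ∃ w, G.Adj v w ∧ w ≠ u ∧ w ≠ u' := by
  classical
  have : 0 < (((G.neighborFinset v).erase u).erase u').card := by
    have := Finset.pred_card_le_card_erase (s := G.neighborFinset v) (a := u)
    have := Finset.pred_card_le_card_erase (s := (G.neighborFinset v).erase u) (a := u')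
    rw [card_neighborFinset_eq_degree, hreg v] at *
    omega
  obtain ⟨w, hw⟩ := Finset.card_pos.1 this
  rw [Finset.mem_erase, Finset.mem_erase, mem_neighborFinset] at hw
  exact ⟨w, hw.2.2, hw.2.1, hw.1⟩

/-- Powers of a root of `qF² - λF + 1` of the distance from `a` are eigenfunctions
outside of `a`. -/
theorem IsTree.sum_pow_dist (hT : G.IsTree) (hreg : G.IsRegularOfDegree (q + 1)) {v a : V}
    (hva : v ≠ a) {F l : ℝ} (hF : q * F ^ 2 + 1 = l * F) :
    ∑ w ∈ G.neighborFinset v, F ^ G.dist w a = l * F ^ G.dist v a := by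
  obtain ⟨w, hw, hd⟩ := hT.exists_adj_dist_eq_add_one hva
  rw [hreg.sum_neighborFinset hw (y := F ^ (G.dist w a + 2)), hd]
  · linear_combination F ^ G.dist w a * hF
  · intro u hu hne
    rcases hT.dist_adj_cases hu a with h | h
    · exact absurd (hT.eq_of_adj_of_dist_eq_add_one hu hw h hd) hne
    · rw [h, hd]

end Neighbors

section Boundary

variable {v₀ : V}

theorem IsTree.dist_treeBoundary (hT : G.IsTree) (ω : G.TreeBoundary v₀) (n : ℕ) :
    G.dist v₀ (ω.1 n) = n := by
  have key : ∀ n, G.dist v₀ (ω.1 n) = n ∧ G.dist v₀ (ω.1 (n + 1)) = n + 1 := by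
    intro n
    induction n with
    | zero =>
      have := ω.2.2.1 0
      rw [ω.2.1] at this
      simpa [ω.2.1] using this
    | succ n ih =>
      refine ⟨ih.2, ?_⟩
      rcases hT.dist_eq_dist_add_one_of_adj v₀ (ω.2.2.1 (n + 1)) with h | h
      · have := hT.eq_of_adj_of_dist_eq_add_one (ω.2.2.1 (n + 1)) (ω.2.2.1 n).symm (b := v₀)
          (by rw [dist_comm, h, dist_comm])
          (by rw [dist_comm, ih.2, dist_comm, ih.1])
        have := ω.2.2.2 this
        omega
      · omega
  exact (key n).1

/-- A turn back towards `v` would give `ω (n + 1)` two neighbours nearer to `v`, against the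
injectivity of the ray. -/
theorem IsTree.dist_treeBoundary_step (hT : G.IsTree) (ω : G.TreeBoundary v₀) (v : V) {n : ℕ}
    (h : G.dist v (ω.1 (n + 1)) = G.dist v (ω.1 n) + 1) :
    G.dist v (ω.1 (n + 2)) = G.dist v (ω.1 (n + 1)) + 1 := by
  rcases hT.dist_eq_dist_add_one_of_adj v (ω.2.2.1 (n + 1)) with h' | h'
  · have := hT.eq_of_adj_of_dist_eq_add_one (ω.2.2.1 (n + 1)) (ω.2.2.1 n).symm (b := v)
      (by rw [dist_comm, h', dist_comm]) (by rw [dist_comm, h, dist_comm])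
    have := ω.2.2.2 this
    omega
  · exact h'

/-- After time `d(v₀, v)`, the ray `ω` moves away from `v`. -/
theorem IsTree.dist_treeBoundary_succ (hT : G.IsTree) (ω : G.TreeBoundary v₀) (v : V) {n : ℕ}
    (hn : G.dist v₀ v ≤ n) : G.dist v (ω.1 (n + 1)) = G.dist v (ω.1 n) + 1 := by
  -- The ray approaches `v` at every step until it begins to recede, which then lasts forever. The
  -- approach takes at most `d(v, v₀)` steps.
  have key : ∀ m, G.dist v (ω.1 m) + m = G.dist v v₀ ∨
      G.dist v (ω.1 (m + 1)) = G.dist v (ω.1 m) + 1 := by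
    intro m
    induction m with
    | zero => left; rw [ω.2.1]; rfl
    | succ m ih =>
      rcases ih with ih | ih
      · rcases hT.dist_eq_dist_add_one_of_adj v (ω.2.2.1 m) with h | h
        · left; omega
        · right; exact hT.dist_treeBoundary_step ω v h
      · right; exact hT.dist_treeBoundary_step ω v ih
  rcases key n with h | h
  · rw [dist_comm] at hn
    rcases hT.dist_eq_dist_add_one_of_adj v (ω.2.2.1 n) with h' | h'
    · omega
    · exact h'
  · exact h

theorem IsTree.dist_treeBoundary_add (hT : G.IsTree) (ω : G.TreeBoundary v₀) (v : V) {n : ℕ}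
    (hn : G.dist v₀ v ≤ n) (k : ℕ) : G.dist v (ω.1 (n + k)) = G.dist v (ω.1 n) + k := by
  induction k with
  | zero => rfl
  | succ k ih => rw [← add_assoc, hT.dist_treeBoundary_succ ω v (by omega), ih, add_assoc]

/-- From time `n` on both distances grow by one per step, so their difference is frozen. The
asymptotic condition thus depends on the single vertex `ω n`, hence is locally constant in `ω`. -/
theorem IsTree.leadsTowards_iff (hT : G.IsTree) (ω : G.TreeBoundary v₀) {v w : V} {n : ℕ}
    (hv : G.dist v₀ v ≤ n) (hw : G.dist v₀ w ≤ n) :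
    LeadsTowards ω v w ↔ G.dist v (ω.1 n) = G.dist w (ω.1 n) + 1 := by
  have key : ∀ k, G.dist v (ω.1 (n + k)) = G.dist w (ω.1 (n + k)) + 1 ↔
      G.dist v (ω.1 n) = G.dist w (ω.1 n) + 1 := fun k => by
    rw [hT.dist_treeBoundary_add ω v hv, hT.dist_treeBoundary_add ω w hw]; omega
  constructor
  · intro h
    obtain ⟨m, hm, hnm⟩ := (h.and (eventually_ge_atTop n)).exists
    obtain ⟨k, rfl⟩ := Nat.exists_eq_add_of_le hnm
    exact (key k).1 hm
  · intro h
    refine (eventually_ge_atTop n).mono fun m hm => ?_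
    obtain ⟨k, rfl⟩ := Nat.exists_eq_add_of_le hm
    exact (key k).2 h

theorem IsTree.leadsTowards_or (hT : G.IsTree) (ω : G.TreeBoundary v₀) {v w : V} (h : G.Adj v w) :
    LeadsTowards ω v w ∨ LeadsTowards ω w v := by
  have hv := le_max_left (G.dist v₀ v) (G.dist v₀ w)
  have hw := le_max_right (G.dist v₀ v) (G.dist v₀ w)
  rw [hT.leadsTowards_iff ω hv hw, hT.leadsTowards_iff ω hw hv]
  exact hT.dist_adj_cases h _

theorem LeadsTowards.not_symm {ω : G.TreeBoundary v₀} {v w : V} (h : LeadsTowards ω v w) :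
    ¬ LeadsTowards ω w v := fun h' => by
  obtain ⟨n, h1, h2⟩ := (h.and h').exists
  omega

theorem IsTree.leadsTowards_unique (hT : G.IsTree) {ω : G.TreeBoundary v₀} {v w w' : V}
    (hw : G.Adj v w) (hw' : G.Adj v w') (h : LeadsTowards ω v w) (h' : LeadsTowards ω v w') :
    w = w' := by
  obtain ⟨n, h1, h2⟩ := (h.and h').exists
  exact hT.eq_of_adj_of_dist_eq_add_one hw hw' h1 h2

theorem IsTree.exists_leadsTowards (hT : G.IsTree) (ω : G.TreeBoundary v₀) (v : V) :
    ∃ w, G.Adj v w ∧ LeadsTowards ω v w := by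
  have hne : v ≠ ω.1 (G.dist v₀ v + 1) := fun h => by
    have := hT.dist_treeBoundary ω (G.dist v₀ v + 1)
    rw [← h] at this
    omega
  obtain ⟨w, hw, hd⟩ := hT.exists_adj_dist_eq_add_one hne
  refine ⟨w, hw, (hT.leadsTowards_iff ω (Nat.le_succ _) ?_).2 hd⟩
  have := hT.dist_eq_dist_add_one_of_adj v₀ hw
  omega

theorem IsTree.leadsTowards_ray (hT : G.IsTree) (ω : G.TreeBoundary v₀) (n : ℕ) :
    LeadsTowards ω (ω.1 n) (ω.1 (n + 1)) := by
  rw [hT.leadsTowards_iff ω (n := n + 1) (by rw [hT.dist_treeBoundary]; omega)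
    (by rw [hT.dist_treeBoundary]), dist_self]
  simpa using ω.2.2.1 n

theorem TreeBoundary.ext {ω ω' : G.TreeBoundary v₀} (h : ∀ n, ω.1 n = ω'.1 n) : ω = ω' :=
  Subtype.ext (funext h)

end Boundary

end SimpleGraph

/-! ### Path space of the dynamic graph, cylinders and their masses. -/

namespace SimpleGraph

variable {V : Type u} {G : SimpleGraph V} {v₀ : V}

theorem exists_walk_length {f : ℕ → V} (h0 : f 0 = v₀) (hadj : ∀ n, G.Adj (f n) (f (n + 1)))
    (n : ℕ) : ∃ p : G.Walk v₀ (f n), p.length = n := by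
  induction n with
  | zero => exact ⟨Walk.nil.copy rfl h0.symm, by simp⟩
  | succ n ih =>
    obtain ⟨p, hp⟩ := ih
    exact ⟨p.concat (hadj n), by simp [hp]⟩

theorem exists_ray (hG : ∀ v, ∃ w, G.Adj v w) (v : V) :
    ∃ g : ℕ → V, g 0 = v ∧ ∀ k, G.Adj (g k) (g (k + 1)) := by
  choose s hs using hG
  refine ⟨fun k => s^[k] v, rfl, fun k => by
    simpa only [Function.iterate_succ_apply'] using hs _⟩

variable [G.LocallyFinite]

/-- The position in the original graph of a path of the dynamic graph at time `n`. -/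
def pos (x : (G.pascalization v₀).Path) (n : ℕ) : V := G.pascalizationVertex (x.1 n)

theorem pos_zero (x : (G.pascalization v₀).Path) : pos x 0 = v₀ :=
  congrArg (fun v => G.pascalizationVertex v) ((G.pascalization v₀).eq_root (x.1 0))

theorem pos_adj (x : (G.pascalization v₀).Path) (n : ℕ) : G.Adj (pos x n) (pos x (n + 1)) := x.2 n

theorem pascalizationVertex_injective {n : ℕ} :
    Function.Injective (G.pascalizationVertex (v₀ := v₀) (n := n)) := Subtype.val_injective

theorem path_ext {x y : (G.pascalization v₀).Path} (h : ∀ n, pos x n = pos y n) : x = y :=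
  Subtype.ext (funext fun n => pascalizationVertex_injective (h n))

/-- The path of the dynamic graph with given positions. -/
def mkPath (f : ℕ → V) (h0 : f 0 = v₀) (hadj : ∀ n, G.Adj (f n) (f (n + 1))) :
    (G.pascalization v₀).Path :=
  ⟨fun n => (⟨f n, exists_walk_length h0 hadj n⟩ : {v : V // ∃ p : G.Walk v₀ v, p.length = n}),
    hadj⟩

@[simp] theorem pos_mkPath (f : ℕ → V) (h0 : f 0 = v₀) (hadj : ∀ n, G.Adj (f n) (f (n + 1)))
    (n : ℕ) : pos (mkPath f h0 hadj) n = f n := rfl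

/-- The set of all paths that agree with `y` up to time `n`. -/
def Cyl (n : ℕ) (y : (G.pascalization v₀).Path) : Set (G.pascalization v₀).Path :=
  {x | ∀ k ≤ n, pos x k = pos y k}

theorem self_mem_cyl (n : ℕ) (x : (G.pascalization v₀).Path) : x ∈ Cyl n x := fun _ _ => rfl

theorem cyl_eq_of_mem {n : ℕ} {x y : (G.pascalization v₀).Path} (h : y ∈ Cyl n x) :
    Cyl n y = Cyl n x :=
  Set.ext fun z => forall₂_congr fun k hk => by rw [h k hk]

theorem mem_cyl_comm {n : ℕ} {x y : (G.pascalization v₀).Path} : y ∈ Cyl n x ↔ x ∈ Cyl n y :=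
  ⟨fun h k hk => (h k hk).symm, fun h k hk => (h k hk).symm⟩

theorem cyl_anti (x : (G.pascalization v₀).Path) {m n : ℕ} (h : m ≤ n) : Cyl n x ⊆ Cyl m x :=
  fun _ hy k hk => hy k (hk.trans h)

theorem cyl_zero (x : (G.pascalization v₀).Path) : Cyl 0 x = Set.univ :=
  Set.eq_univ_of_forall fun y k hk => by
    obtain rfl : k = 0 := by omega
    rw [pos_zero, pos_zero]

theorem cyl_eq_or_disjoint (n : ℕ) (x y : (G.pascalization v₀).Path) :
    Cyl n x = Cyl n y ∨ Disjoint (Cyl n x) (Cyl n y) := by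
  by_cases h : ∃ z, z ∈ Cyl n x ∧ z ∈ Cyl n y
  · obtain ⟨z, hx, hy⟩ := h
    exact Or.inl (by rw [← cyl_eq_of_mem hx, cyl_eq_of_mem hy])
  · exact Or.inr (Set.disjoint_left.2 fun z hx hy => h ⟨z, hx, hy⟩)

theorem cyl_succ_eq {n : ℕ} {x y : (G.pascalization v₀).Path} (hy : y ∈ Cyl n x) :
    Cyl (n + 1) y = Cyl n x ∩ {z | pos z (n + 1) = pos y (n + 1)} := by
  ext z
  constructor
  · exact fun h => ⟨fun k hk => by rw [h k (by omega), hy k hk], h _ le_rfl⟩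
  · rintro ⟨h1, h2⟩ k hk
    rcases Nat.lt_or_ge n k with h | h
    · obtain rfl : k = n + 1 := by omega
      exact h2
    · rw [h1 k h, hy k h]

theorem isClopen_pos (n : ℕ) (S : Set V) :
    IsClopen {x : (G.pascalization v₀).Path | pos x n ∈ S} := by
  have hc : Continuous fun x : (G.pascalization v₀).Path => x.1 n :=
    (continuous_apply n).comp continuous_subtype_val
  exact (isClopen_discrete {v : (G.pascalization v₀).level n | G.pascalizationVertex v ∈ S}).preimage
    hc

theorem isClopen_cyl (n : ℕ) (y : (G.pascalization v₀).Path) : IsClopen (Cyl n y) := by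
  have : Cyl n y = ⋂ k ∈ Set.Iic n, {x | pos x k ∈ ({pos y k} : Set V)} := by
    ext x; simp [Cyl]
  rw [this]
  exact (Set.finite_Iic n).isClopen_biInter fun k _ => isClopen_pos k _

theorem measurableSet_cyl (n : ℕ) (y : (G.pascalization v₀).Path) : MeasurableSet (Cyl n y) :=
  (isClopen_cyl n y).2.measurableSet

theorem measurableSet_pos (n : ℕ) (S : Set V) :
    MeasurableSet {x : (G.pascalization v₀).Path | pos x n ∈ S} :=
  (isClopen_pos n S).2.measurableSet

/-- Follow `x` up to time `n`, then follow `g`. -/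
def append (x : (G.pascalization v₀).Path) (n : ℕ) (g : ℕ → V) (h0 : g 0 = pos x n)
    (hadj : ∀ k, G.Adj (g k) (g (k + 1))) : (G.pascalization v₀).Path :=
  mkPath (fun k => if k ≤ n then pos x k else g (k - n)) (by simp [pos_zero]) fun k => by
    rcases lt_trichotomy k n with h | rfl | h
    · simpa [h.le, Nat.succ_le_of_lt h] using pos_adj x k
    · simpa [← h0] using hadj 0
    · have h1 : ¬ k ≤ n := by omega
      have h2 : ¬ k + 1 ≤ n := by omega
      simp only [h1, h2, if_false, show k + 1 - n = k - n + 1 by omega]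
      exact hadj _

theorem pos_append_of_le {x : (G.pascalization v₀).Path} {n : ℕ} {g : ℕ → V} {h0 : g 0 = pos x n}
    {hadj : ∀ k, G.Adj (g k) (g (k + 1))} {k : ℕ} (hk : k ≤ n) :
    pos (append x n g h0 hadj) k = pos x k := by
  simp [append, hk]

theorem pos_append_add {x : (G.pascalization v₀).Path} {n : ℕ} {g : ℕ → V} {h0 : g 0 = pos x n}
    {hadj : ∀ k, G.Adj (g k) (g (k + 1))} (k : ℕ) :
    pos (append x n g h0 hadj) (n + k) = g k := by
  cases k with
  | zero => rw [h0]; exact pos_append_of_le le_rfl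
  | succ k => simp [append]

theorem append_mem_cyl {x : (G.pascalization v₀).Path} {n : ℕ} {g : ℕ → V} {h0 : g 0 = pos x n}
    {hadj : ∀ k, G.Adj (g k) (g (k + 1))} : append x n g h0 hadj ∈ Cyl n x :=
  fun _ hk => pos_append_of_le hk

section Extension

theorem nonempty_path (hG : ∀ v, ∃ w, G.Adj v w) : Nonempty (G.pascalization v₀).Path := by
  obtain ⟨g, h0, hg⟩ := exists_ray hG v₀
  exact ⟨mkPath g h0 hg⟩

theorem exists_mem_cyl_pos_succ (hG : ∀ v, ∃ w, G.Adj v w) (x : (G.pascalization v₀).Path) (n : ℕ)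
    {w : V} (hw : G.Adj (pos x n) w) : ∃ y ∈ Cyl n x, pos y (n + 1) = w := by
  obtain ⟨g, h0, hg⟩ := exists_ray hG w
  refine ⟨append x n (fun k => Nat.casesOn k (pos x n) g) rfl fun k => ?_, append_mem_cyl, ?_⟩
  · cases k with
    | zero => rwa [← h0] at hw
    | succ k => exact hg k
  · exact (pos_append_add 1).trans h0

theorem exists_pos_add_two (hG : ∀ v, ∃ w, G.Adj v w) (x : (G.pascalization v₀).Path) (n : ℕ) :
    ∃ y : (G.pascalization v₀).Path, pos y (n + 2) = pos x n := by
  obtain ⟨y, hy, h⟩ := exists_mem_cyl_pos_succ hG x (n + 1) (pos_adj x n).symm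
  exact ⟨y, h⟩

/-- Without dead ends every finite path extends to an infinite one, so cylinders may be indexed by
infinite paths. -/
theorem exists_cylinder_eq_cyl (hG : ∀ v, ∃ w, G.Adj v w) {n : ℕ}
    (p : (G.pascalization v₀).FinPath n) :
    ∃ x : (G.pascalization v₀).Path, (∀ k (h : k ≤ n), x.1 k = p.1 k h) ∧
      GradedGraph.cylinder p = Cyl n x := by
  suffices h : ∃ x : (G.pascalization v₀).Path, ∀ k (h : k ≤ n), x.1 k = p.1 k h by
    obtain ⟨x, hx⟩ := h
    refine ⟨x, hx, Set.ext fun y => forall₂_congr fun k hk => ?_⟩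
    rw [← hx]
    exact pascalizationVertex_injective.eq_iff.symm
  induction n with
  | zero =>
    obtain ⟨x⟩ := nonempty_path (v₀ := v₀) hG
    refine ⟨x, fun k h => ?_⟩
    obtain rfl : k = 0 := by omega
    rw [(G.pascalization v₀).eq_root (x.1 0), (G.pascalization v₀).eq_root (p.1 0 h)]
  | succ n ih =>
    obtain ⟨x, hx⟩ := ih ⟨fun k h => p.1 k (h.trans (Nat.le_succ n)),
      fun k h => p.2 k (h.trans (Nat.le_succ n))⟩
    have hadj : G.Adj (pos x n) (G.pascalizationVertex (p.1 (n + 1) le_rfl)) := by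
      have := p.2 n le_rfl
      rw [← hx n le_rfl] at this
      exact this
    obtain ⟨y, hy, hw⟩ := exists_mem_cyl_pos_succ hG x n hadj
    refine ⟨y, fun k h => pascalizationVertex_injective ?_⟩
    rcases Nat.lt_or_ge n k with hk | hk
    · obtain rfl : k = n + 1 := by omega
      exact hw
    · rw [← hx k hk]
      exact hy k hk

end Extension

/-- The initial segment of a path. -/
def initial (n : ℕ) (x : (G.pascalization v₀).Path) : (G.pascalization v₀).FinPath n :=
  ⟨fun k _ => x.1 k, fun k _ => x.2 k⟩

theorem cylinder_initial (n : ℕ) (x : (G.pascalization v₀).Path) :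
    GradedGraph.cylinder (initial n x) = Cyl n x :=
  Set.ext fun _ => forall₂_congr fun _ _ => pascalizationVertex_injective.eq_iff.symm

instance (n : ℕ) : Finite ((G.pascalization v₀).FinPath n) :=
  Finite.of_injective (fun p (k : Set.Iic n) => p.1 k.1 k.2) fun _ _ h =>
    Subtype.ext (funext fun k => funext fun hk => congrFun h ⟨k, hk⟩)

theorem exists_cyl_subset {U : Set (G.pascalization v₀).Path} (hU : IsOpen U)
    {x : (G.pascalization v₀).Path} (hx : x ∈ U) : ∃ n, Cyl n x ⊆ U := by
  obtain ⟨W, hW, rfl⟩ := isOpen_induced_iff.1 hU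
  obtain ⟨I, u, hu, hIW⟩ := isOpen_pi_iff.1 hW x.1 hx
  refine ⟨I.sup id, fun y hy => hIW fun k hk => ?_⟩
  have : y.1 k = x.1 k := pascalizationVertex_injective (hy k (Finset.le_sup (f := id) hk))
  rw [this]
  exact (hu k hk).2

instance (n : ℕ) : SecondCountableTopology ((G.pascalization v₀).level n) :=
  have : Countable ((G.pascalization v₀).level n) := Finite.to_countable
  DiscreteTopology.secondCountableTopology_of_countable

instance : SecondCountableTopology (G.pascalization v₀).Path :=
  Topology.IsEmbedding.subtypeVal.secondCountableTopology

instance : TopologicalSpace.MetrizableSpace (G.pascalization v₀).Path :=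
  Topology.IsEmbedding.subtypeVal.metrizableSpace

/-- The π-system of cylinder sets. -/
def cylinders (G : SimpleGraph V) [G.LocallyFinite] (v₀ : V) : Set (Set (G.pascalization v₀).Path) :=
  {s | s = ∅ ∨ ∃ n x, s = Cyl n x}

theorem isPiSystem_cylinders : IsPiSystem (cylinders G v₀) := by
  rintro s (rfl | ⟨n, x, rfl⟩) t (rfl | ⟨m, y, rfl⟩) ⟨z, hz⟩
  · exact Or.inl (by simp)
  · exact Or.inl (by simp)
  · exact Or.inl (by simp)
  · right
    rw [← cyl_eq_of_mem hz.1, ← cyl_eq_of_mem hz.2]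
    rcases le_total m n with h | h
    · exact ⟨n, z, Set.inter_eq_left.2 (cyl_anti z h)⟩
    · exact ⟨m, z, Set.inter_eq_right.2 (cyl_anti z h)⟩

theorem measurableSet_of_mem_cylinders {s : Set (G.pascalization v₀).Path}
    (hs : s ∈ cylinders G v₀) : MeasurableSet s := by
  rcases hs with rfl | ⟨n, x, rfl⟩
  · exact MeasurableSet.empty
  · exact measurableSet_cyl n x

theorem isTopologicalBasis_cylinders : TopologicalSpace.IsTopologicalBasis (cylinders G v₀) := by
  refine TopologicalSpace.isTopologicalBasis_of_isOpen_of_nhds ?_ ?_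
  · rintro s (rfl | ⟨n, x, rfl⟩)
    · exact isOpen_empty
    · exact (isClopen_cyl n x).isOpen
  · intro x U hx hU
    obtain ⟨n, hn⟩ := exists_cyl_subset hU hx
    exact ⟨_, Or.inr ⟨n, x, rfl⟩, self_mem_cyl n x, hn⟩

section Measure

variable (μ ν : Measure (G.pascalization v₀).Path)

theorem sum_measure_cyl_inter (n : ℕ) (x : (G.pascalization v₀).Path) :
    ∑ w ∈ G.neighborFinset (pos x n), μ (Cyl n x ∩ {y | pos y (n + 1) = w}) = μ (Cyl n x) := by
  rw [← measure_biUnion_finset]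
  · congr 1
    ext y
    simp only [mem_neighborFinset, Set.mem_iUnion, Set.mem_inter_iff, Set.mem_ofPred_eq]
    constructor
    · rintro ⟨_, _, h, _⟩; exact h
    · exact fun h => ⟨pos y (n + 1), by rw [← h n le_rfl]; exact pos_adj y n, h, rfl⟩
  · intro w _ w' _ hne
    exact Set.disjoint_left.2 fun y hy hy' => hne (hy.2.symm.trans hy'.2)
  · exact fun w _ => (measurableSet_cyl n x).inter (measurableSet_pos (n + 1) {w})

theorem sum_measureReal_cyl_inter [IsFiniteMeasure μ] (n : ℕ) (x : (G.pascalization v₀).Path) :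
    ∑ w ∈ G.neighborFinset (pos x n), μ.real (Cyl n x ∩ {y | pos y (n + 1) = w}) =
      μ.real (Cyl n x) := by
  simp only [Measure.real]
  rw [← sum_measure_cyl_inter μ n x, ENNReal.toReal_sum fun _ _ => measure_ne_top _ _]

variable {μ ν}

/-- A cylinder is the disjoint union of its one-step refinements, so equality from level `N` on
descends to all levels. The freedom in `N` serves the splicing argument, where only levels beyond
the splice are compared. -/
theorem measure_ext_cyl [IsFiniteMeasure μ] [IsFiniteMeasure ν] (hG : ∀ v, ∃ w, G.Adj v w) (N : ℕ)
    (h : ∀ n, N ≤ n → ∀ x, μ (Cyl n x) = ν (Cyl n x)) : μ = ν := by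
  have hall : ∀ k n, n + k = N → ∀ x, μ (Cyl n x) = ν (Cyl n x) := by
    intro k
    induction k with
    | zero => exact fun n hn => h n (by omega)
    | succ k ih =>
      intro n hn x
      rw [← sum_measure_cyl_inter, ← sum_measure_cyl_inter ν]
      refine Finset.sum_congr rfl fun w hw => ?_
      obtain ⟨y, hy, rfl⟩ := exists_mem_cyl_pos_succ hG x n (by simpa using hw)
      rw [← cyl_succ_eq hy]
      exact ih (n + 1) (by omega) y
  have hall' : ∀ n x, μ (Cyl n x) = ν (Cyl n x) := fun n x => by
    rcases le_total N n with hn | hn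
    · exact h n hn x
    · exact hall (N - n) n (by omega) x
  refine ext_of_generate_finite (cylinders G v₀) ?_ isPiSystem_cylinders ?_ ?_
  · rw [BorelSpace.measurable_eq (α := (G.pascalization v₀).Path),
      isTopologicalBasis_cylinders.borel_eq_generateFrom]
  · rintro s (rfl | ⟨n, x, rfl⟩)
    · simp
    · exact hall' n x
  · obtain ⟨x⟩ := nonempty_path (v₀ := v₀) hG
    rw [← cyl_zero x, hall']

/-- Cylinders are clopen, closed under intersection and form a base, so their masses control weak
convergence. -/
theorem tendsto_of_tendsto_cyl {ι : Type*} {l : Filter ι} [l.IsCountablyGenerated]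
    {m : ι → ProbabilityMeasure (G.pascalization v₀).Path}
    {m' : ProbabilityMeasure (G.pascalization v₀).Path}
    (h : ∀ n x, Tendsto (fun i => (m i : Measure (G.pascalization v₀).Path).real (Cyl n x)) l
      (𝓝 ((m' : Measure (G.pascalization v₀).Path).real (Cyl n x)))) : Tendsto m l (𝓝 m') := by
  refine isPiSystem_cylinders.tendsto_probabilityMeasure_of_tendsto_of_mem
    (fun s hs => measurableSet_of_mem_cylinders hs) ?_ ?_
  · intro U hU x hx
    obtain ⟨n, hn⟩ := exists_cyl_subset hU hx
    exact ⟨_, Or.inr ⟨n, x, rfl⟩, (isClopen_cyl n x).isOpen.mem_nhds (self_mem_cyl n x), hn⟩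
  · rintro s (rfl | ⟨n, x, rfl⟩)
    · simpa using tendsto_const_nhds
    · exact NNReal.tendsto_coe.1 (h n x)

/-- `μ` gives the same mass to any two initial segments with the same endpoint. -/
def IsInv (μ : Measure (G.pascalization v₀).Path) : Prop :=
  ∀ n x y, pos x n = pos y n → μ (Cyl n x) = μ (Cyl n y)

open Classical in
/-- The mass of an initial segment of length `n` with endpoint `v`. -/
noncomputable def segMass (μ : Measure (G.pascalization v₀).Path) (n : ℕ) (v : V) : ℝ :=
  -- The chosen path is immaterial under `IsInv`; the value `0` at vertices that do not occur keeps
  -- the function nonnegative everywhere.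
  if h : ∃ x : (G.pascalization v₀).Path, pos x n = v then μ.real (Cyl n h.choose) else 0

/-- Harmonicity of a function on the dynamic graph. -/
def IsHarm (v₀ : V) (g : ℕ → V → ℝ) : Prop :=
  ∀ (x : (G.pascalization v₀).Path) (n : ℕ),
    g n (pos x n) = ∑ w ∈ G.neighborFinset (pos x n), g (n + 1) w

theorem IsInv.segMass_pos (h : IsInv μ) (n : ℕ) (x : (G.pascalization v₀).Path) :
    segMass μ n (pos x n) = μ.real (Cyl n x) := by
  have hx : ∃ y : (G.pascalization v₀).Path, pos y n = pos x n := ⟨x, rfl⟩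
  rw [segMass, dif_pos hx, Measure.real, Measure.real, h n _ _ hx.choose_spec]

theorem segMass_nonneg (n : ℕ) (v : V) : 0 ≤ segMass μ n v := by
  unfold segMass
  split
  · exact measureReal_nonneg
  · exact le_rfl

theorem IsInv.segMass_zero [IsProbabilityMeasure μ] (hG : ∀ v, ∃ w, G.Adj v w) (h : IsInv μ) :
    segMass μ 0 v₀ = 1 := by
  obtain ⟨x⟩ := nonempty_path (v₀ := v₀) hG
  have := h.segMass_pos 0 x
  rwa [pos_zero, cyl_zero, probReal_univ] at this

theorem IsInv.isHarm [IsFiniteMeasure μ] (hG : ∀ v, ∃ w, G.Adj v w) (h : IsInv μ) :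
    IsHarm (G := G) v₀ (segMass μ) := fun x n => by
  rw [h.segMass_pos, ← sum_measureReal_cyl_inter]
  refine Finset.sum_congr rfl fun w hw => ?_
  obtain ⟨y, hy, rfl⟩ := exists_mem_cyl_pos_succ hG x n (by simpa using hw)
  rw [← cyl_succ_eq hy, h.segMass_pos]

end Measure

end SimpleGraph

/-! ### Central measures as invariant measures. -/

namespace SimpleGraph

variable {V : Type u} {G : SimpleGraph V} {v₀ : V} [G.LocallyFinite]

/-- Replace the initial segment of length `n` of a path by that of `y`, whenever this is
possible. -/
noncomputable def splice (y : (G.pascalization v₀).Path) (n : ℕ) (x : (G.pascalization v₀).Path) :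
    (G.pascalization v₀).Path :=
  open Classical in
  if h : pos x n = pos y n then append y n (fun k => pos x (n + k)) h fun k => pos_adj x (n + k)
  else x

theorem pos_splice_of_le {x y : (G.pascalization v₀).Path} {n : ℕ} (h : pos x n = pos y n) {k : ℕ}
    (hk : k ≤ n) : pos (splice y n x) k = pos y k := by
  rw [splice, dif_pos h, pos_append_of_le hk]

theorem pos_splice_of_ge (x y : (G.pascalization v₀).Path) {n k : ℕ} (hk : n ≤ k) :
    pos (splice y n x) k = pos x k := by
  by_cases h : pos x n = pos y n
  · obtain ⟨k, rfl⟩ := Nat.exists_eq_add_of_le hk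
    rw [splice, dif_pos h, pos_append_add]
  · rw [splice, dif_neg h]

/-- The first coordinates of the spliced path depend on finitely many coordinates of the argument:
the map is even continuous. -/
theorem measurable_splice (y : (G.pascalization v₀).Path) (n : ℕ) :
    Measurable (splice y n) := by
  refine measurable_of_isOpen fun U hU => ?_
  refine IsOpen.measurableSet (isOpen_iff_mem_nhds.2 fun x hx => ?_)
  obtain ⟨m, hm⟩ := exists_cyl_subset hU hx
  refine mem_of_superset ((isClopen_cyl (max m n) x).2.mem_nhds (self_mem_cyl _ x)) fun z hz => ?_
  refine hm fun k hk => ?_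
  have hzn := hz n (le_max_right _ _)
  rcases le_total n k with h | h
  · rw [pos_splice_of_ge _ _ h, pos_splice_of_ge _ _ h, hz k (hk.trans (le_max_left _ _))]
  · by_cases hy : pos x n = pos y n
    · rw [pos_splice_of_le hy h, pos_splice_of_le (hzn.trans hy) h]
    · rw [splice, splice, dif_neg hy, dif_neg (by rwa [hzn]),
        hz k (hk.trans (le_max_left _ _))]

/-- Exchanging initial segments matches the deeper cylinders inside `Cyl n x` with those inside `Cyl
n y` without changing endpoints, and invariance equates their masses. -/
theorem IsInv.map_splice {μ : Measure (G.pascalization v₀).Path} [IsFiniteMeasure μ]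
    (hG : ∀ v, ∃ w, G.Adj v w) (h : IsInv μ) {n : ℕ} {x y : (G.pascalization v₀).Path}
    (hxy : pos x n = pos y n) :
    (μ.restrict (Cyl n x)).map (splice y n) = μ.restrict (Cyl n y) := by
  refine measure_ext_cyl hG n fun m hm s => ?_
  rw [Measure.map_apply (measurable_splice y n) (measurableSet_cyl m s),
    Measure.restrict_apply (measurable_splice y n (measurableSet_cyl m s)),
    Measure.restrict_apply (measurableSet_cyl m s)]
  by_cases hs : s ∈ Cyl n y
  · have h1 : Cyl m s ∩ Cyl n y = Cyl m s := by
      rw [← cyl_eq_of_mem hs]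
      exact Set.inter_eq_left.2 (cyl_anti s hm)
    have hsx : pos s n = pos x n := (hs n le_rfl).trans hxy.symm
    -- Splicing the segment of `x` back into `s` inverts the exchange.
    have h2 : splice y n ⁻¹' Cyl m s ∩ Cyl n x = Cyl m (splice x n s) := by
      ext z
      constructor
      · rintro ⟨hz, hzx⟩ k hk
        rcases le_total n k with h | h
        · rw [pos_splice_of_ge _ _ h, ← hz k hk, pos_splice_of_ge _ _ h]
        · rw [pos_splice_of_le hsx h, hzx k h]
      · intro hz
        have hzx : z ∈ Cyl n x := fun k hk => by
          rw [hz k (hk.trans hm), pos_splice_of_le hsx hk]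
        refine ⟨fun k hk => ?_, hzx⟩
        rcases le_total n k with h | h
        · rw [pos_splice_of_ge _ _ h, hz k hk, pos_splice_of_ge _ _ h]
        · rw [pos_splice_of_le ((hzx n le_rfl).trans hxy) h, hs k h]
    rw [h1, h2]
    exact h m _ _ (pos_splice_of_ge _ _ hm)
  · have h1 : Cyl m s ∩ Cyl n y = ∅ := by
      ext z
      simp only [Set.mem_inter_iff, Set.mem_empty_iff_false, iff_false, not_and]
      exact fun hz hzy => hs fun k hk => by rw [← hz k (hk.trans hm), hzy k hk]
    have h2 : splice y n ⁻¹' Cyl m s ∩ Cyl n x = ∅ := by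
      ext z
      simp only [Set.mem_inter_iff, Set.mem_empty_iff_false, iff_false, not_and]
      exact fun hz hzx => hs fun k hk => by
        rw [← hz k (hk.trans hm), pos_splice_of_le ((hzx n le_rfl).trans hxy) hk]
    rw [h1, h2]

/-- Under an invariant measure, the past does not influence the future. -/
theorem IsInv.measure_cyl_inter {μ : Measure (G.pascalization v₀).Path} [IsFiniteMeasure μ]
    (hG : ∀ v, ∃ w, G.Adj v w) (h : IsInv μ) {n : ℕ} {x y : (G.pascalization v₀).Path}
    (hxy : pos x n = pos y n) {A : Set (G.pascalization v₀).Path}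
    (hA : MeasurableSet[(G.pascalization v₀).tailAlgebra n] A) :
    μ (Cyl n x ∩ A) = μ (Cyl n y ∩ A) := by
  obtain ⟨hA1, hA2⟩ := hA
  have key : ∀ z, splice y n z ∈ A ↔ z ∈ A := fun z =>
    ⟨hA2 _ _ fun k hk => pascalizationVertex_injective (pos_splice_of_ge _ _ hk),
      hA2 _ _ fun k hk => pascalizationVertex_injective (pos_splice_of_ge _ _ hk).symm⟩
  have h1 := congrArg (fun ν : Measure _ => ν A) (h.map_splice hG hxy)
  simp only [Measure.map_apply (measurable_splice y n) hA1, Measure.restrict_apply hA1,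
    Measure.restrict_apply (measurable_splice y n hA1)] at h1
  rw [Set.inter_comm, Set.inter_comm _ A, ← h1]
  congr 1
  ext z
  simp [key]

/-- A tail event lies in the tail algebra of every level, so exchanging initial segments preserves
it. Tail events thus yield harmonic functions dominated by `segMass μ`. -/
theorem IsInv.restrict {μ : Measure (G.pascalization v₀).Path} [IsFiniteMeasure μ]
    (hG : ∀ v, ∃ w, G.Adj v w) (h : IsInv μ) {A : Set (G.pascalization v₀).Path}
    (hA : MeasurableSet[⨅ n, (G.pascalization v₀).tailAlgebra n] A) : IsInv (μ.restrict A) := by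
  intro n x y hxy
  rw [Measure.restrict_apply (measurableSet_cyl _ _), Measure.restrict_apply (measurableSet_cyl _ _)]
  exact h.measure_cyl_inter hG hxy (MeasurableSpace.measurableSet_iInf.1 hA n)

/-- All segments ending at the same vertex meet a future event in equal mass, so a past event
contributes only its number of segments. This factorization gives both halves of centrality. -/
theorem IsInv.measure_initial_mem {μ : Measure (G.pascalization v₀).Path} [IsFiniteMeasure μ]
    (hG : ∀ v, ∃ w, G.Adj v w) (h : IsInv μ) {n : ℕ} {x : (G.pascalization v₀).Path}
    {A : Set (G.pascalization v₀).Path}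
    (hA : MeasurableSet[(G.pascalization v₀).tailAlgebra n] A)
    (Q : Finset ((G.pascalization v₀).FinPath n)) (hQ : ∀ p ∈ Q, p.last = x.1 n) :
    μ ({y | initial n y ∈ Q} ∩ A) = Q.card * μ (Cyl n x ∩ A) := by
  have h1 : {y | initial n y ∈ Q} ∩ A = ⋃ p ∈ Q, GradedGraph.cylinder p ∩ A := by
    ext y
    simp only [Set.mem_inter_iff, Set.mem_iUnion, exists_prop]
    constructor
    · rintro ⟨hy, hyA⟩
      exact ⟨_, hy, by rw [cylinder_initial]; exact self_mem_cyl n y, hyA⟩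
    · rintro ⟨p, hp, hy, hyA⟩
      refine ⟨?_, hyA⟩
      have : initial n y = p := Subtype.ext (funext fun k => funext fun hk => hy k hk)
      exact (congrArg (· ∈ Q) this).mpr hp
  have hcyl : ∀ p ∈ Q, μ (GradedGraph.cylinder p ∩ A) = μ (Cyl n x ∩ A) := fun p hp => by
    obtain ⟨z, hz, hpz⟩ := exists_cylinder_eq_cyl hG p
    rw [hpz]
    refine h.measure_cyl_inter hG ?_ hA
    exact congrArg (fun v => G.pascalizationVertex v) ((hz n le_rfl).trans (hQ p hp))
  rw [h1, measure_biUnion_finset, Finset.sum_congr rfl hcyl, Finset.sum_const, nsmul_eq_mul]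
  · intro p _ p' _ hne
    refine Set.disjoint_left.2 fun y hy hy' => hne ?_
    exact Subtype.ext (funext fun k => funext fun hk => (hy.1 k hk).symm.trans (hy'.1 k hk))
  · intro p _
    obtain ⟨z, -, hpz⟩ := exists_cylinder_eq_cyl hG p
    rw [hpz]
    exact (measurableSet_cyl n z).inter hA.1

theorem measurableSet_through {n : ℕ} (v : (G.pascalization v₀).level n) :
    MeasurableSet (GradedGraph.through v) := by
  convert measurableSet_pos (v₀ := v₀) (G := G) n {G.pascalizationVertex v} using 1
  exact Set.ext fun x => pascalizationVertex_injective.eq_iff.symm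

theorem measurable_coord (n : ℕ) : Measurable fun x : (G.pascalization v₀).Path => x.1 n :=
  (measurable_pi_apply n).comp measurable_subtype_coe

theorem IsInv.isCentral {μ : ProbabilityMeasure (G.pascalization v₀).Path}
    (hG : ∀ v, ∃ w, G.Adj v w) (h : IsInv (μ : Measure (G.pascalization v₀).Path)) :
    GradedGraph.IsCentral μ := by
  classical
  have hfin : ∀ n, Fintype ((G.pascalization v₀).FinPath n) := fun n => Fintype.ofFinite _
  have huniv : ∀ n, MeasurableSet[(G.pascalization v₀).tailAlgebra n] Set.univ :=
    fun n => MeasurableSet.univ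
  have hthrough : ∀ n (x : (G.pascalization v₀).Path), GradedGraph.through (x.1 n) =
      {y | initial n y ∈ (Finset.univ.filter fun p : (G.pascalization v₀).FinPath n =>
        p.last = x.1 n)} := fun n x => by
    ext y
    rw [Set.mem_ofPred_eq, Finset.mem_filter]
    exact ⟨fun hy => ⟨Finset.mem_univ _, hy⟩, fun hy => hy.2⟩
  constructor
  · intro n v
    by_cases hv : (μ : Measure (G.pascalization v₀).Path) (GradedGraph.through v) = 0
    · rw [ProbabilityTheory.cond_eq_zero_of_meas_eq_zero hv]
      simp [IndepFun_iff]
    · obtain ⟨x, rfl⟩ : ∃ x : (G.pascalization v₀).Path, x.1 n = v := nonempty_of_measure_ne_zero hv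
      rw [indepFun_iff_measure_inter_preimage_eq_mul]
      intro s t _ ht
      set B := (fun (x : (G.pascalization v₀).Path) (k : Set.Iio n) => x.1 (k : ℕ)) ⁻¹' s with hB
      set A := (fun (x : (G.pascalization v₀).Path) (k : Set.Ioi n) => x.1 (k : ℕ)) ⁻¹' t with hAdef
      have hA : MeasurableSet[(G.pascalization v₀).tailAlgebra n] A := by
        refine ⟨?_, fun y z hyz hy => ?_⟩
        · exact (measurable_pi_lambda _ fun k => measurable_coord _) ht
        · have : (fun k : Set.Ioi n => z.1 (k : ℕ)) = fun k : Set.Ioi n => y.1 (k : ℕ) :=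
            funext fun k => (hyz k (le_of_lt k.2)).symm
          change (fun k : Set.Ioi n => z.1 (k : ℕ)) ∈ t
          rw [this]
          exact hy
      set Q := Finset.univ.filter fun p : (G.pascalization v₀).FinPath n => p.last = x.1 n with hQ
      -- `Q` lists all segments ending at the given vertex, and `Q'` those realizing the past event.
      set Q' := Q.filter fun p => (fun k : Set.Iio n => p.1 (k : ℕ) (le_of_lt k.2)) ∈ s with hQ'
      have hTB : GradedGraph.through (x.1 n) ∩ B = {y | initial n y ∈ Q'} := by
        rw [hthrough]
        ext y
        simp only [hQ', Set.mem_inter_iff, Set.mem_ofPred_eq, Finset.mem_filter (s := Q)]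
        exact Iff.rfl
      have e1 := h.measure_initial_mem hG hA Q' (x := x)
        fun p hp => (Finset.mem_filter.1 (Finset.mem_filter.1 hp).1).2
      have e2 := h.measure_initial_mem hG (huniv n) Q' (x := x)
        fun p hp => (Finset.mem_filter.1 (Finset.mem_filter.1 hp).1).2
      have e3 := h.measure_initial_mem hG hA Q (x := x) (by simp [hQ])
      have e4 := h.measure_initial_mem hG (huniv n) Q (x := x) (by simp [hQ])
      simp only [cond_apply (measurableSet_through _)]
      rw [← Set.inter_assoc, hTB, e1]
      simp only [Set.inter_univ] at e2 e4
      rw [e2, hthrough, e3]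
      rw [hthrough] at hv
      set M := (μ : Measure (G.pascalization v₀).Path) {y | initial n y ∈ Q} with hM
      have hMM : M⁻¹ * M = 1 := ENNReal.inv_mul_cancel hv (measure_ne_top _ _)
      -- A factor `M⁻¹ * M = 1` is inserted and `M` expanded as `Q.card` times the mass of one
      -- cylinder; this supplies the second normalization.
      calc M⁻¹ * (Q'.card * (μ : Measure (G.pascalization v₀).Path) (Cyl n x ∩ A))
          = (M⁻¹ * M) * (M⁻¹ * (Q'.card * (μ : Measure (G.pascalization v₀).Path) (Cyl n x ∩ A))) := by
            rw [hMM, one_mul]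
        _ = (M⁻¹ * (Q.card * (μ : Measure (G.pascalization v₀).Path) (Cyl n x))) *
          (M⁻¹ * (Q'.card * (μ : Measure (G.pascalization v₀).Path) (Cyl n x ∩ A))) := by rw [← e4]
        _ = _ := by ring
  · intro n v hv p hp
    obtain ⟨x, hx, hpx⟩ := exists_cylinder_eq_cyl hG p
    obtain rfl : x.1 n = v := (hx n le_rfl).trans hp
    have e4 := h.measure_initial_mem hG (huniv n) (x := x)
      (Finset.univ.filter fun p : (G.pascalization v₀).FinPath n => p.last = x.1 n) (by simp)
    rw [Set.inter_univ, Set.inter_univ, ← hthrough] at e4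
    have hsub : GradedGraph.through (x.1 n) ∩ Cyl n x = Cyl n x :=
      Set.inter_eq_right.2 fun y hy => pascalizationVertex_injective (hy n le_rfl)
    have hdim : GradedGraph.dim (x.1 n) = (Finset.univ.filter fun
        p : (G.pascalization v₀).FinPath n => p.last = x.1 n).card := by
      rw [GradedGraph.dim, Nat.card_eq_fintype_card, Fintype.card_subtype]
    rw [cond_apply (measurableSet_through _), hpx, hsub, hdim]
    rw [e4] at hv ⊢
    have h0 : (μ : Measure (G.pascalization v₀).Path) (Cyl n x) ≠ 0 := right_ne_zero_of_mul hv
    rw [ENNReal.mul_inv (Or.inr (measure_ne_top _ _)) (Or.inr h0), mul_assoc,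
      ENNReal.inv_mul_cancel h0 (measure_ne_top _ _), mul_one]

/-- At a vertex of positive measure both segments have conditional probability `1 / dim v`; at a
null vertex both masses vanish. -/
theorem isInv_of_isCentral {μ : ProbabilityMeasure (G.pascalization v₀).Path}
    (h : GradedGraph.IsCentral μ) : IsInv (μ : Measure (G.pascalization v₀).Path) := by
  intro n x y hxy
  have hsub : ∀ z : (G.pascalization v₀).Path, pos z n = pos x n →
      GradedGraph.through (x.1 n) ∩ Cyl n z = Cyl n z := fun z hz =>
    Set.inter_eq_right.2 fun u hu => pascalizationVertex_injective ((hu n le_rfl).trans hz)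
  by_cases hv : (μ : Measure (G.pascalization v₀).Path) (GradedGraph.through (x.1 n)) = 0
  · rw [← hsub x rfl, ← hsub y hxy.symm, measure_mono_null Set.inter_subset_left hv,
      measure_mono_null Set.inter_subset_left hv]
  · have h1 := h.2 n _ hv (initial n x) rfl
    have h2 := h.2 n _ hv (initial n y) (pascalizationVertex_injective hxy.symm)
    rw [← h2, cond_apply (measurableSet_through _), cond_apply (measurableSet_through _),
      cylinder_initial, cylinder_initial, hsub x rfl, hsub y hxy.symm] at h1
    exact (ENNReal.mul_right_inj (ENNReal.inv_ne_zero.2 (measure_ne_top _ _))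
      (ENNReal.inv_ne_top.2 hv)).1 h1

end SimpleGraph

/-! ### Density martingales and extremality of ergodic measures. -/

namespace SimpleGraph

variable {V : Type u} {G : SimpleGraph V} {v₀ : V} [G.LocallyFinite]

/-- The filtration generated by the initial segments of the paths. -/
def pathFiltration (G : SimpleGraph V) [G.LocallyFinite] (v₀ : V) :
    Filtration ℕ (inferInstance : MeasurableSpace (G.pascalization v₀).Path) where
  seq n :=
    { MeasurableSet' := fun A => MeasurableSet A ∧ ∀ x, x ∈ A → Cyl n x ⊆ A
      measurableSet_empty := ⟨MeasurableSet.empty, fun _ h => h.elim⟩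
      measurableSet_compl := fun _ hA => ⟨hA.1.compl, fun _ hx _ hy hyA =>
        hx (hA.2 _ hyA (mem_cyl_comm.1 hy))⟩
      measurableSet_iUnion := fun _ hf => ⟨MeasurableSet.iUnion fun i => (hf i).1, fun x hx => by
        obtain ⟨i, hi⟩ := Set.mem_iUnion.1 hx
        exact ((hf i).2 x hi).trans (Set.subset_iUnion _ i)⟩ }
  mono' _ _ hmn _ hA := ⟨hA.1, fun x hx => (cyl_anti x hmn).trans (hA.2 x hx)⟩
  le' _ _ hA := hA.1

section Ratio

variable {μ : Measure (G.pascalization v₀).Path} {g : ℕ → V → ℝ}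

/-- The density of a function on the dynamic graph with respect to a measure, along a path. -/
noncomputable def massRatio (μ : Measure (G.pascalization v₀).Path) (g : ℕ → V → ℝ) (n : ℕ)
    (x : (G.pascalization v₀).Path) : ℝ := g n (pos x n) / segMass μ n (pos x n)

theorem massRatio_eq_of_mem {n : ℕ} {x y : (G.pascalization v₀).Path} (h : y ∈ Cyl n x) :
    massRatio μ g n y = massRatio μ g n x := by
  rw [massRatio, massRatio, h n le_rfl]

theorem measurable_massRatio (n : ℕ) :
    Measurable[pathFiltration G v₀ n] (massRatio μ g n) := fun s _ =>
  ⟨measurableSet_pos n {v | g n v / segMass μ n v ∈ s}, fun x hx y hy => by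
    rw [Set.mem_preimage, massRatio_eq_of_mem hy]; exact hx⟩

theorem massRatio_mem (h0 : ∀ (x : (G.pascalization v₀).Path) n, 0 ≤ g n (pos x n))
    (hle : ∀ (x : (G.pascalization v₀).Path) n, g n (pos x n) ≤ segMass μ n (pos x n)) (n : ℕ)
    (x : (G.pascalization v₀).Path) : |massRatio μ g n x| ≤ 1 := by
  rw [massRatio, abs_of_nonneg (div_nonneg (h0 x n) (segMass_nonneg n _))]
  exact div_le_one_of_le₀ (hle x n) (segMass_nonneg n _)

theorem integrable_massRatio [IsFiniteMeasure μ]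
    (h0 : ∀ (x : (G.pascalization v₀).Path) n, 0 ≤ g n (pos x n))
    (hle : ∀ (x : (G.pascalization v₀).Path) n, g n (pos x n) ≤ segMass μ n (pos x n)) (n : ℕ) :
    Integrable (massRatio μ g n) μ :=
  Integrable.of_bound ((measurable_massRatio n).mono ((pathFiltration G v₀).le n)
    le_rfl).aestronglyMeasurable 1 (Eventually.of_forall fun x => massRatio_mem h0 hle n x)

/-- Harmonicity of `g` says that summing over one more step changes nothing. The value is therefore
independent of `k`, which lets `k` tend to infinity later. -/
theorem IsInv.setIntegral_massRatio [IsFiniteMeasure μ] (hG : ∀ v, ∃ w, G.Adj v w) (h : IsInv μ)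
    (hg : IsHarm (G := G) v₀ g)
    (h0 : ∀ (x : (G.pascalization v₀).Path) n, 0 ≤ g n (pos x n))
    (hle : ∀ (x : (G.pascalization v₀).Path) n, g n (pos x n) ≤ segMass μ n (pos x n)) (k n : ℕ)
    (x : (G.pascalization v₀).Path) :
    ∫ y in Cyl n x, massRatio μ g (n + k) y ∂μ = g n (pos x n) := by
  induction k generalizing n x with
  | zero =>
    rw [add_zero, setIntegral_congr_fun (g := fun _ => massRatio μ g n x) (measurableSet_cyl n x)
      fun y hy => massRatio_eq_of_mem hy, setIntegral_const, smul_eq_mul, ← h.segMass_pos, massRatio]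
    -- At a vertex of mass `0` the quotient is `0` by convention; domination forces `g` to vanish
    -- there too.
    rcases (segMass_nonneg (μ := μ) n (pos x n)).eq_or_lt with h1 | h1
    · have h2 := hle x n
      rw [← h1] at h2 ⊢
      rw [zero_mul]
      exact le_antisymm (h0 x n) h2
    · exact mul_div_cancel₀ _ h1.ne'
  | succ k ih =>
    have hU : Cyl n x = ⋃ w ∈ G.neighborFinset (pos x n), Cyl n x ∩ {y | pos y (n + 1) = w} := by
      ext y
      simp only [mem_neighborFinset, Set.mem_iUnion, Set.mem_inter_iff, Set.mem_ofPred_eq]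
      exact ⟨fun h => ⟨pos y (n + 1), by rw [← h n le_rfl]; exact pos_adj y n, h, rfl⟩,
        fun ⟨_, _, h, _⟩ => h⟩
    rw [hU, integral_biUnion_finset, hg x n]
    · refine Finset.sum_congr rfl fun w hw => ?_
      obtain ⟨y, hy, rfl⟩ := exists_mem_cyl_pos_succ hG x n (by simpa using hw)
      rw [← cyl_succ_eq hy, ← ih, show n + (k + 1) = n + 1 + k by ring]
    · exact fun w _ => (measurableSet_cyl n x).inter (measurableSet_pos (n + 1) {w})
    · intro w _ w' _ hne
      exact Set.disjoint_left.2 fun y hy hy' => hne (hy.2.symm.trans hy'.2)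
    · exact fun w _ => (integrable_massRatio h0 hle _).integrableOn

theorem IsInv.martingale_massRatio [IsFiniteMeasure μ] (hG : ∀ v, ∃ w, G.Adj v w) (h : IsInv μ)
    (hg : IsHarm (G := G) v₀ g)
    (h0 : ∀ (x : (G.pascalization v₀).Path) n, 0 ≤ g n (pos x n))
    (hle : ∀ (x : (G.pascalization v₀).Path) n, g n (pos x n) ≤ segMass μ n (pos x n)) :
    Martingale (massRatio μ g) (pathFiltration G v₀) μ := by
  classical
  refine martingale_of_setIntegral_eq_succ (fun n => (measurable_massRatio n).stronglyMeasurable)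
    (integrable_massRatio h0 hle) fun n s hs => ?_
  have hfin : Fintype ((G.pascalization v₀).FinPath n) := Fintype.ofFinite _
  -- A set of the `n`th algebra is a finite disjoint union of cylinders of length `n`, so it
  -- suffices to compare integrals over cylinders.
  set Q := Finset.univ.filter fun p : (G.pascalization v₀).FinPath n => ∃ y ∈ s, initial n y = p
  have hU : s = ⋃ p ∈ Q, GradedGraph.cylinder p := by
    ext y
    simp only [Set.mem_iUnion, exists_prop]
    constructor
    · intro hy
      refine ⟨initial n y, Finset.mem_filter.2 ⟨Finset.mem_univ _, y, hy, rfl⟩, ?_⟩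
      rw [cylinder_initial]
      exact self_mem_cyl n y
    · rintro ⟨p, hp, hy⟩
      obtain ⟨z, hz, rfl⟩ := (Finset.mem_filter.1 hp).2
      rw [cylinder_initial] at hy
      exact hs.2 z hz hy
  have hcyl : ∀ p ∈ Q, ∃ z : (G.pascalization v₀).Path, GradedGraph.cylinder p = Cyl n z :=
    fun p hp => by
      obtain ⟨z, hz, rfl⟩ := (Finset.mem_filter.1 hp).2
      exact ⟨z, cylinder_initial n z⟩
  have hmeas : ∀ p ∈ Q, MeasurableSet (GradedGraph.cylinder p) := fun p hp => by
    obtain ⟨z, hz⟩ := hcyl p hp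
    rw [hz]
    exact measurableSet_cyl n z
  have hdisj : Set.Pairwise ↑Q (Function.onFun Disjoint fun p : (G.pascalization v₀).FinPath n =>
      GradedGraph.cylinder p) := fun p _ p' _ hne =>
    Set.disjoint_left.2 fun y hy hy' => hne <|
      Subtype.ext (funext fun k => funext fun hk => (hy k hk).symm.trans (hy' k hk))
  rw [hU, integral_biUnion_finset _ hmeas hdisj fun p _ => (integrable_massRatio h0 hle _).integrableOn,
    integral_biUnion_finset _ hmeas hdisj fun p _ => (integrable_massRatio h0 hle _).integrableOn]
  refine Finset.sum_congr rfl fun p hp => ?_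
  obtain ⟨z, hz⟩ := hcyl p hp
  rw [hz, h.setIntegral_massRatio hG hg h0 hle 1]
  exact h.setIntegral_massRatio hG hg h0 hle 0 n z

end Ratio

/-- Extremality: a nonnegative harmonic function that is dominated by the cylinder masses of an
ergodic central measure is proportional to them. -/
theorem IsInv.eq_mul_segMass {μ : ProbabilityMeasure (G.pascalization v₀).Path}
    (hG : ∀ v, ∃ w, G.Adj v w) (h : IsInv (μ : Measure (G.pascalization v₀).Path))
    (herg : GradedGraph.IsErgodic μ) {g : ℕ → V → ℝ} (hg : IsHarm (G := G) v₀ g)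
    (h0 : ∀ (x : (G.pascalization v₀).Path) n, 0 ≤ g n (pos x n))
    (hle : ∀ (x : (G.pascalization v₀).Path) n,
      g n (pos x n) ≤ segMass (μ : Measure (G.pascalization v₀).Path) n (pos x n))
    (x : (G.pascalization v₀).Path) (n : ℕ) :
    g n (pos x n) = g 0 v₀ * segMass (μ : Measure (G.pascalization v₀).Path) n (pos x n) := by
  set m : Measure (G.pascalization v₀).Path := (μ : Measure (G.pascalization v₀).Path) with hm
  have hmart := h.martingale_massRatio hG hg h0 hle
  have hlim := hmart.submartingale.exists_ae_tendsto_of_bdd (R := 1) fun n => by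
    refine (eLpNorm_le_of_ae_bound (C := 1)
      (Eventually.of_forall fun x => massRatio_mem h0 hle n x)).trans ?_
    simp
  -- The `limsup` is a version of the limit that is defined everywhere and is unchanged by altering
  -- an initial segment, so its level sets are genuine tail events.
  set Y : (G.pascalization v₀).Path → ℝ := fun x => limsup (fun n => massRatio m g n x) atTop with hY
  have hYlim : ∀ᵐ x ∂m, Tendsto (fun n => massRatio m g n x) atTop (𝓝 (Y x)) := by
    filter_upwards [hlim] with x ⟨c, hc⟩
    have : Y x = c := hc.limsup_eq
    rwa [this]
  have hYmeas : Measurable Y := Measurable.limsup fun n =>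
    (measurable_massRatio n).mono ((pathFiltration G v₀).le n) le_rfl
  obtain ⟨t, ht⟩ : ∃ t, Y =ᵐ[m] Function.const _ t := by
    refine exists_eventuallyEq_const_of_forall_separating MeasurableSet fun U hU => ?_
    have hA : MeasurableSet[⨅ n, (G.pascalization v₀).tailAlgebra n] (Y ⁻¹' U) := by
      refine MeasurableSpace.measurableSet_iInf.2 fun N => ⟨hYmeas hU, fun y z hyz hy => ?_⟩
      have : Y z = Y y := by
        refine limsup_congr ((eventually_ge_atTop N).mono fun k hk => ?_)
        have : pos z k = pos y k := congrArg (fun v => G.pascalizationVertex v) (hyz k hk).symm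
        rw [massRatio, massRatio, this]
      rwa [Set.mem_preimage, this]
    rcases herg _ hA with h1 | h1
    · exact Or.inr (measure_eq_zero_iff_ae_notMem.1 h1)
    · exact Or.inl ((mem_ae_iff_prob_eq_one (hYmeas hU)).2 h1)
  have key : ∀ n x, g n (pos x n) = t * segMass m n (pos x n) := fun n x => by
    -- These integrals all equal `g n (pos x n)`, while dominated convergence sends them to `t`
    -- times the mass of the cylinder.
    have h1 : Tendsto (fun k => ∫ y in Cyl n x, massRatio m g (n + k) y ∂m) atTop
        (𝓝 (∫ _ in Cyl n x, t ∂m)) := by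
      refine tendsto_integral_of_dominated_convergence (fun _ => 1)
        (fun k => (integrable_massRatio h0 hle _).aestronglyMeasurable.restrict)
        (integrable_const _) (fun k => Eventually.of_forall fun y => massRatio_mem h0 hle _ y) ?_
      refine ae_restrict_of_ae ?_
      filter_upwards [hYlim, ht] with y hy hyt
      rw [hyt] at hy
      simpa only [add_comm n, Function.const] using (tendsto_add_atTop_iff_nat n).2 hy
    simp only [h.setIntegral_massRatio hG hg h0 hle] at h1
    rw [tendsto_nhds_unique tendsto_const_nhds h1, setIntegral_const, h.segMass_pos, smul_eq_mul,
      mul_comm]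
  have h2 := key 0 x
  rw [pos_zero, h.segMass_zero hG, mul_one] at h2
  rw [h2, key]

end SimpleGraph

/-! ### Compactness of the boundary; existence, centrality and continuity of `λ_{ω,r}`. -/

namespace SimpleGraph

variable {V : Type u} {G : SimpleGraph V} {v₀ : V}

section Compactness

theorem continuous_treeBoundary_coe : @Continuous (G.TreeBoundary v₀) (ℕ → V) _
    (@Pi.topologicalSpace ℕ (fun _ => V) (fun _ => ⊥)) (fun ω => ω.1) :=
  continuous_induced_dom

theorem eventually_treeBoundary_eq (ω : G.TreeBoundary v₀) (n : ℕ) :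
    ∀ᶠ ω' in 𝓝 ω, ω'.1 n = ω.1 n := by
  let : TopologicalSpace V := ⊥
  have : DiscreteTopology V := ⟨rfl⟩
  have h : Continuous fun ω : G.TreeBoundary v₀ => ω.1 n :=
    (continuous_apply n).comp continuous_treeBoundary_coe
  exact h.continuousAt.eventually (IsOpen.mem_nhds (isOpen_discrete {ω.1 n}) rfl)

instance : FirstCountableTopology (G.TreeBoundary v₀) := by
  let : TopologicalSpace V := ⊥
  have : DiscreteTopology V := ⟨rfl⟩
  have h : Topology.IsInducing (fun ω : G.TreeBoundary v₀ => ω.1) := ⟨rfl⟩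
  exact h.firstCountableTopology

/-- Rays form a closed subset of a product of finite sets: each defining condition involves at most
two coordinates. -/
instance [G.LocallyFinite] : CompactSpace (G.TreeBoundary v₀) := by
  let : TopologicalSpace V := ⊥
  have : DiscreteTopology V := ⟨rfl⟩
  have h : Topology.IsInducing (fun ω : G.TreeBoundary v₀ => ω.1) := ⟨rfl⟩
  have hpair : ∀ (m n : ℕ) (S : Set (V × V)), IsClosed {f : ℕ → V | (f m, f n) ∈ S} := fun m n S =>
    (isClosed_discrete S).preimage ((continuous_apply m).prodMk (continuous_apply n))
  refine ⟨h.isCompact_iff.2 ?_⟩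
  have hcomp : IsCompact (Set.pi Set.univ
      fun n : ℕ => {v : V | ∃ p : G.Walk v₀ v, p.length = n}) :=
    isCompact_univ_pi fun n => (G.finite_walk_length v₀ n).isCompact
  refine hcomp.of_isClosed_subset ?_ ?_
  · have : (fun ω : G.TreeBoundary v₀ => ω.1) '' Set.univ =
        {f | (f 0, f 0) ∈ {p : V × V | p.1 = v₀}} ∩
          (⋂ n, {f : ℕ → V | (f n, f (n + 1)) ∈ {p : V × V | G.Adj p.1 p.2}}) ∩
          ⋂ (m) (n), {f : ℕ → V | (f m, f n) ∈ {p : V × V | p.1 = p.2 → m = n}} := by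
      ext f
      simp only [Set.image_univ, Set.mem_range, Set.mem_inter_iff, Set.mem_iInter,
        Set.mem_ofPred_eq]
      exact ⟨fun ⟨ω, hω⟩ => hω ▸ ⟨⟨ω.2.1, ω.2.2.1⟩, fun _ _ h => ω.2.2.2 h⟩,
        fun ⟨⟨h1, h2⟩, h3⟩ => ⟨⟨f, h1, h2, fun m n h => h3 m n h⟩, rfl⟩⟩
    rw [this]
    exact ((hpair 0 0 _).inter (isClosed_iInter fun n => hpair n (n + 1) _)).inter
      (isClosed_iInter fun m => isClosed_iInter fun n => hpair m n _)
  · rintro _ ⟨ω, -, rfl⟩ n -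
    exact exists_walk_length ω.2.1 ω.2.2.1 n

end Compactness

section StepProb

variable {q : ℕ} {ω : G.TreeBoundary v₀} {r : ℝ}

theorem stepProb_of_leadsTowards {v w : V} (h : LeadsTowards ω v w) : stepProb q ω r v w = r :=
  if_pos h

theorem stepProb_of_not_leadsTowards {v w : V} (h : ¬ LeadsTowards ω v w) :
    stepProb q ω r v w = (1 - r) / q := if_neg h

theorem stepProb_nonneg (hr : r ∈ Set.Icc (0 : ℝ) 1) (v w : V) : 0 ≤ stepProb q ω r v w := by
  unfold stepProb
  split
  · exact hr.1
  · exact div_nonneg (by linarith [hr.2]) (Nat.cast_nonneg q)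

theorem IsTree.sum_stepProb_mul [G.LocallyFinite] (hT : G.IsTree) {v w : V} (hw : G.Adj v w)
    (h : LeadsTowards ω v w) (f : V → ℝ) :
    ∑ u ∈ G.neighborFinset v, stepProb q ω r v u * f u =
      r * f w + (1 - r) / q * (∑ u ∈ G.neighborFinset v, f u - f w) := by
  classical
  have hw' : w ∈ G.neighborFinset v := by simpa using hw
  rw [← Finset.add_sum_erase _ _ hw', ← Finset.add_sum_erase _ f hw', stepProb_of_leadsTowards h,
    add_sub_cancel_left, Finset.mul_sum]
  congr 1
  refine Finset.sum_congr rfl fun u hu => ?_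
  rw [Finset.mem_erase, mem_neighborFinset] at hu
  rw [stepProb_of_not_leadsTowards fun h' => hu.1 (hT.leadsTowards_unique hu.2 hw h' h)]

theorem IsTree.sum_stepProb [G.LocallyFinite] (hT : G.IsTree) (hreg : G.IsRegularOfDegree (q + 1))
    (hq : q ≠ 0) (v : V) : ∑ u ∈ G.neighborFinset v, stepProb q ω r v u = 1 := by
  obtain ⟨w, hw, h⟩ := hT.exists_leadsTowards ω v
  have h1 := hT.sum_stepProb_mul (q := q) (r := r) hw h fun _ => 1
  have h2 := hreg.sum_neighborFinset_const v (f := fun _ => 1) (y := 1) fun _ _ => rfl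
  simp only [mul_one] at h1 h2
  rw [h1, h2]
  have : (q : ℝ) ≠ 0 := Nat.cast_ne_zero.2 hq
  field_simp
  ring

/-- The direction of a fixed edge depends on only one vertex of `ω`, so it is locally constant; the
dependence on `r` is affine. -/
theorem IsTree.tendsto_stepProb (hT : G.IsTree) (ω : G.TreeBoundary v₀) (r : ℝ) (v w : V) :
    Tendsto (fun p : G.TreeBoundary v₀ × ℝ => stepProb q p.1 p.2 v w) (𝓝 (ω, r))
      (𝓝 (stepProb q ω r v w)) := by
  set m := max (G.dist v₀ v) (G.dist v₀ w)
  have hv : G.dist v₀ v ≤ m := le_max_left _ _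
  have hw : G.dist v₀ w ≤ m := le_max_right _ _
  have hev : ∀ᶠ p : G.TreeBoundary v₀ × ℝ in 𝓝 (ω, r),
      (LeadsTowards p.1 v w ↔ LeadsTowards ω v w) := by
    filter_upwards [(continuous_fst.tendsto (ω, r)).eventually (eventually_treeBoundary_eq ω m)]
      with p hp
    rw [hT.leadsTowards_iff p.1 hv hw, hT.leadsTowards_iff ω hv hw, hp]
  have hr : Tendsto (fun p : G.TreeBoundary v₀ × ℝ => p.2) (𝓝 (ω, r)) (𝓝 r) :=
    continuous_snd.tendsto (ω, r)
  by_cases h : LeadsTowards ω v w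
  · rw [stepProb_of_leadsTowards h]
    exact hr.congr' (hev.mono fun p hp => (stepProb_of_leadsTowards (hp.2 h)).symm)
  · rw [stepProb_of_not_leadsTowards h]
    exact ((tendsto_const_nhds.sub hr).div_const _).congr'
      (hev.mono fun p hp => (stepProb_of_not_leadsTowards fun h' => h (hp.1 h')).symm)

end StepProb

variable [G.LocallyFinite]

theorem measurable_of_measurableSet_preimage_cyl {α : Type*} [MeasurableSpace α]
    {f : α → (G.pascalization v₀).Path} (h : ∀ n x, MeasurableSet (f ⁻¹' Cyl n x)) :
    Measurable f := by
  have h1 : (inferInstance : MeasurableSpace (G.pascalization v₀).Path) =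
      MeasurableSpace.generateFrom (cylinders G v₀) :=
    (BorelSpace.measurable_eq (α := (G.pascalization v₀).Path)).trans
      isTopologicalBasis_cylinders.borel_eq_generateFrom
  have h2 : Measurable[_, MeasurableSpace.generateFrom (cylinders G v₀)] f := by
    refine measurable_generateFrom ?_
    rintro s (rfl | ⟨n, x, rfl⟩)
    · exact MeasurableSet.empty
    · exact h n x
  rw [← h1] at h2
  exact h2

/-- Existence of the Markov chain on the dynamic graph with given transition probabilities. -/
theorem exists_measure_cyl_eq_prod {P : V → V → ℝ} (h0 : ∀ v w, 0 ≤ P v w)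
    (h1 : ∀ v, ∑ w ∈ G.neighborFinset v, P v w = 1) :
    ∃ μ : ProbabilityMeasure (G.pascalization v₀).Path, ∀ n x,
      (μ : Measure (G.pascalization v₀).Path).real (Cyl n x) =
        ∏ k ∈ Finset.range n, P (pos x k) (pos x (k + 1)) := by
  classical
  let (i : ℕ × V) : MeasurableSpace (G.neighborSet i.2) := ⊤
  have hsum : ∀ i : ℕ × V, ∑ w : G.neighborSet i.2, ENNReal.ofReal (P i.2 w) = 1 := fun i => by
    rw [← ENNReal.ofReal_sum_of_nonneg fun _ _ => h0 _ _]
    have : ∑ w : G.neighborSet i.2, P i.2 w = 1 := by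
      rw [← h1 i.2]
      exact (Finset.sum_subtype _ (fun w => by simp) fun w => P i.2 w).symm
    rw [this, ENNReal.ofReal_one]
  -- For every time `k` and vertex `v`, an independent neighbour of `v` is drawn with law `P v`; the
  -- path follows the draws it meets.
  let ρ (i : ℕ × V) : Measure (G.neighborSet i.2) :=
    (PMF.ofFintype (fun w : G.neighborSet i.2 => ENNReal.ofReal (P i.2 w)) (hsum i)).toMeasure
  have hρ (i : ℕ × V) : IsProbabilityMeasure (ρ i) := PMF.toMeasure.isProbabilityMeasure _
  let f (U : ∀ i : ℕ × V, G.neighborSet i.2) (n : ℕ) : V :=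
    Nat.rec v₀ (fun k v => (U (k, v)).1) n
  let Φ (U : ∀ i : ℕ × V, G.neighborSet i.2) : (G.pascalization v₀).Path :=
    mkPath (f U) rfl fun n => (U (n, f U n)).2
  let t (x : (G.pascalization v₀).Path) (i : ℕ × V) : Set (G.neighborSet i.2) :=
    {w | w.1 = pos x (i.1 + 1)}
  let s (n : ℕ) (x : (G.pascalization v₀).Path) : Finset (ℕ × V) :=
    (Finset.range n).image fun k => (k, pos x k)
  -- Following `x` up to time `n` constrains just the draws at `(k, x_k)` for `k < n`. These indices
  -- are distinct, so the probability is a product.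
  have hpre : ∀ n x, Φ ⁻¹' Cyl n x = Set.pi (s n x) (t x) := by
    intro n x
    ext U
    simp only [Set.mem_preimage, Set.mem_pi, s, Finset.coe_image, Set.forall_mem_image,
      Finset.coe_range, Set.mem_Iio, t, Set.mem_ofPred_eq]
    constructor
    · intro h k hk
      have e1 : f U k = pos x k := h k hk.le
      have e2 : f U (k + 1) = pos x (k + 1) := h (k + 1) hk
      rw [← e2, ← e1]
    · intro h k hk
      induction k with
      | zero => exact (pos_zero x).symm
      | succ k ih =>
        have e1 : f U k = pos x k := ih (by omega)
        have e2 := @h k hk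
        rw [← e1] at e2
        exact e2
  have hmeas : Measurable Φ := measurable_of_measurableSet_preimage_cyl fun n x => by
    rw [hpre]
    exact MeasurableSet.pi (Finset.countable_toSet _) fun i _ => trivial
  refine ⟨⟨(Measure.infinitePi ρ).map Φ, Measure.isProbabilityMeasure_map hmeas.aemeasurable⟩,
    fun n x => ?_⟩
  have hval : (Measure.infinitePi ρ).map Φ (Cyl n x) =
      ENNReal.ofReal (∏ k ∈ Finset.range n, P (pos x k) (pos x (k + 1))) := by
    rw [Measure.map_apply hmeas (measurableSet_cyl n x), hpre,
      Measure.infinitePi_pi ρ fun i _ => MeasurableSpace.measurableSet_top, Finset.prod_image,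
      ENNReal.ofReal_prod_of_nonneg fun _ _ => h0 _ _]
    · refine Finset.prod_congr rfl fun k _ => ?_
      have : t x (k, pos x k) = {(⟨pos x (k + 1), pos_adj x k⟩ : G.neighborSet (pos x k))} :=
        Set.ext fun w => ⟨fun h => Subtype.ext h, fun h => congrArg Subtype.val h⟩
      rw [this]
      exact (PMF.toMeasure_apply_singleton _ _ MeasurableSpace.measurableSet_top).trans (PMF.ofFintype_apply _ _)
    · intro k _ k' _ h
      exact congrArg Prod.fst h
  change ((Measure.infinitePi ρ).map Φ (Cyl n x)).toReal = _
  rw [hval, ENNReal.toReal_ofReal (Finset.prod_nonneg fun _ _ => h0 _ _)]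

section Lambda

variable {q : ℕ} {ω : G.TreeBoundary v₀} {r : ℝ}

theorem isLambda_iff (hG : ∀ v, ∃ w, G.Adj v w) {μ : ProbabilityMeasure (G.pascalization v₀).Path} :
    IsLambda q ω r μ ↔ ∀ n x, (μ : Measure (G.pascalization v₀).Path).real (Cyl n x) =
      ∏ k ∈ Finset.range n, stepProb q ω r (pos x k) (pos x (k + 1)) := by
  constructor
  · intro h n x
    have := h n (initial n x)
    rw [cylinder_initial] at this
    rw [this, Finset.prod_range]
    rfl
  · intro h n p
    obtain ⟨x, hx, hpx⟩ := exists_cylinder_eq_cyl hG p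
    rw [hpx, h, Finset.prod_range]
    refine Finset.prod_congr rfl fun k _ => ?_
    rw [← hx, ← hx]
    rfl

theorem IsTree.exists_isLambda (hT : G.IsTree) (hreg : G.IsRegularOfDegree (q + 1))
    (hq : q ≠ 0) (ω : G.TreeBoundary v₀) (hr : r ∈ Set.Icc (0 : ℝ) 1) :
    ∃ μ : ProbabilityMeasure (G.pascalization v₀).Path, IsLambda q ω r μ := by
  obtain ⟨μ, hμ⟩ := exists_measure_cyl_eq_prod (v₀ := v₀) (fun v w => stepProb_nonneg hr v w)
    fun v => hT.sum_stepProb (ω := ω) hreg hq v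
  exact ⟨μ, (isLambda_iff hreg.exists_adj).2 hμ⟩

theorem eq_of_measureReal_cyl (hG : ∀ v, ∃ w, G.Adj v w)
    {μ ν : ProbabilityMeasure (G.pascalization v₀).Path}
    (h : ∀ n x, (μ : Measure (G.pascalization v₀).Path).real (Cyl n x) =
      (ν : Measure (G.pascalization v₀).Path).real (Cyl n x)) : μ = ν :=
  ProbabilityMeasure.toMeasure_injective (measure_ext_cyl hG 0 fun n _ x =>
    (ENNReal.toReal_eq_toReal_iff' (measure_ne_top _ _) (measure_ne_top _ _)).1 (h n x))

theorem IsLambda.unique (hG : ∀ v, ∃ w, G.Adj v w)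
    {μ ν : ProbabilityMeasure (G.pascalization v₀).Path} (h : IsLambda q ω r μ)
    (h' : IsLambda q ω r ν) : μ = ν :=
  eq_of_measureReal_cyl hG fun n x => by
    rw [(isLambda_iff hG).1 h, (isLambda_iff hG).1 h']

theorem dist_pos_le (hT : G.IsTree) (x : (G.pascalization v₀).Path) (n : ℕ) :
    G.dist v₀ (pos x n) ≤ n := by
  induction n with
  | zero => rw [pos_zero, dist_self]
  | succ n ih =>
    have := hT.dist_eq_dist_add_one_of_adj v₀ (pos_adj x n)
    omega

theorem dist_pos_parity (hT : G.IsTree) (x : (G.pascalization v₀).Path) (n : ℕ) :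
    ∃ k, n = G.dist v₀ (pos x n) + 2 * k := by
  induction n with
  | zero => exact ⟨0, by rw [pos_zero, dist_self]⟩
  | succ n ih =>
    obtain ⟨k, hk⟩ := ih
    rcases hT.dist_eq_dist_add_one_of_adj v₀ (pos_adj x n) with h | h
    · exact ⟨k + 1, by omega⟩
    · exact ⟨k, by omega⟩

/-- The probability of a path under `λ_{ω,r}` is determined by the numbers of steps towards `ω` and
away from `ω`, and the latter are determined by the length and the endpoint of the path. -/
theorem IsTree.prod_stepProb (hT : G.IsTree) (x : (G.pascalization v₀).Path) {n m : ℕ}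
    (hm : n ≤ m) : ∃ t s : ℕ, t + s = n ∧ G.dist (pos x n) (ω.1 m) + t = m + s ∧
      ∏ k ∈ Finset.range n, stepProb q ω r (pos x k) (pos x (k + 1)) =
        r ^ t * ((1 - r) / q) ^ s := by
  -- The distance to `ω m` starts at `m`, drops at steps towards `ω` and rises at the others; since
  -- `n ≤ m`, the vertex `ω m` is remote enough to decide each direction.
  induction n with
  | zero => exact ⟨0, 0, rfl, by rw [pos_zero, hT.dist_treeBoundary], by simp⟩
  | succ n ih =>
    obtain ⟨t, s, h1, h2, h3⟩ := ih (by omega)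
    have hl := hT.leadsTowards_iff ω (v := pos x n) (w := pos x (n + 1)) (n := m)
      ((dist_pos_le hT x n).trans (by omega)) ((dist_pos_le hT x (n + 1)).trans hm)
    rw [Finset.prod_range_succ, h3]
    rcases hT.dist_adj_cases (pos_adj x n) (ω.1 m) with h | h
    · refine ⟨t + 1, s, by omega, by omega, ?_⟩
      rw [stepProb_of_leadsTowards (hl.2 h)]
      ring
    · refine ⟨t, s + 1, by omega, by omega, ?_⟩
      rw [stepProb_of_not_leadsTowards fun h' => by have := hl.1 h'; omega]
      ring

theorem IsLambda.isInv (hT : G.IsTree) (hG : ∀ v, ∃ w, G.Adj v w)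
    {μ : ProbabilityMeasure (G.pascalization v₀).Path} (h : IsLambda q ω r μ) :
    IsInv (μ : Measure (G.pascalization v₀).Path) := by
  intro n x y hxy
  refine (ENNReal.toReal_eq_toReal_iff' (measure_ne_top _ _) (measure_ne_top _ _)).1 ?_
  change Measure.real _ _ = Measure.real _ _
  rw [(isLambda_iff hG).1 h, (isLambda_iff hG).1 h]
  obtain ⟨t, s, h1, h2, h3⟩ := hT.prod_stepProb (q := q) (ω := ω) (r := r) x (le_refl n)
  obtain ⟨t', s', h1', h2', h3'⟩ := hT.prod_stepProb (q := q) (ω := ω) (r := r) y (le_refl n)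
  rw [hxy] at h2
  rw [h3, h3', show t = t' by omega, show s = s' by omega]

/-- Cylinder masses are finite products of transition probabilities, which depend continuously on
the parameters. -/
theorem continuous_of_isLambda {X : Type*} [TopologicalSpace X] [FirstCountableTopology X]
    (hT : G.IsTree) (hG : ∀ v, ∃ w, G.Adj v w) {p : X → G.TreeBoundary v₀ × ℝ} (hp : Continuous p)
    {F : X → ProbabilityMeasure (G.pascalization v₀).Path}
    (hF : ∀ a, IsLambda q (p a).1 (p a).2 (F a)) : Continuous F := by
  refine continuous_iff_continuousAt.2 fun a => tendsto_of_tendsto_cyl fun n x => ?_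
  simp only [(isLambda_iff hG).1 (hF _)]
  exact tendsto_finsetProd _ fun k _ => (hT.tendsto_stepProb (p a).1 (p a).2 _ _).comp (hp.tendsto a)

end Lambda

end SimpleGraph

/-! ### Liouville property and ergodicity for `r ≥ 1/2`. -/

namespace SimpleGraph

variable {V : Type u} {G : SimpleGraph V} {v₀ : V} [G.LocallyFinite]

/-- The vertex `v` is joined with `v₀` by a walk of length `n` (that extends to an infinite one). -/
def Occurs (G : SimpleGraph V) [G.LocallyFinite] (v₀ : V) (n : ℕ) (v : V) : Prop :=
  ∃ x : (G.pascalization v₀).Path, pos x n = v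

theorem occurs_pos (x : (G.pascalization v₀).Path) (n : ℕ) : Occurs G v₀ n (pos x n) := ⟨x, rfl⟩

theorem Occurs.succ (hG : ∀ v, ∃ w, G.Adj v w) {n : ℕ} {v w : V} (h : Occurs G v₀ n v)
    (hw : G.Adj v w) : Occurs G v₀ (n + 1) w := by
  obtain ⟨x, rfl⟩ := h
  obtain ⟨y, -, hy⟩ := exists_mem_cyl_pos_succ hG x n hw
  exact ⟨y, hy⟩

theorem Occurs.add_two (hG : ∀ v, ∃ w, G.Adj v w) {n : ℕ} {v : V} (h : Occurs G v₀ n v) :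
    Occurs G v₀ (n + 2) v := by
  obtain ⟨w, hw⟩ := hG v
  exact (h.succ hG hw).succ hG hw.symm

theorem Occurs.add_two_mul (hG : ∀ v, ∃ w, G.Adj v w) {n : ℕ} {v : V} (h : Occurs G v₀ n v)
    (k : ℕ) : Occurs G v₀ (n + 2 * k) v := by
  induction k with
  | zero => exact h
  | succ k ih => exact ih.add_two hG

section Bounded

variable {q : ℕ} {ω : G.TreeBoundary v₀} {r : ℝ} {h : ℕ → V → ℝ}

/-- Space-time harmonicity with respect to the random walk with parameters `ω` and `r`. -/
def IsStepHarm (q : ℕ) (ω : G.TreeBoundary v₀) (r : ℝ) (h : ℕ → V → ℝ) : Prop :=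
  ∀ n v, Occurs G v₀ n v →
    h n v = ∑ w ∈ G.neighborFinset v, stepProb q ω r v w * h (n + 1) w

/-- This symmetry upgrades the one-sided inequalities below to equalities. -/
theorem IsStepHarm.one_sub (hT : G.IsTree) (hreg : G.IsRegularOfDegree (q + 1)) (hq : q ≠ 0)
    (hh : IsStepHarm q ω r h) : IsStepHarm q ω r fun n v => 1 - h n v := by
  intro n v hv
  simp only [mul_sub, mul_one, Finset.sum_sub_distrib, hT.sum_stepProb hreg hq, ← hh n v hv]

/-- The increment over two time units is itself harmonic. If its supremum `s` were positive, then
near a maximizer it would stay close to `s` along repeated two-step returns to the same vertex, and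
the increments would add up to more than `1`. -/
theorem IsStepHarm.apply_add_two_le (hT : G.IsTree) (hreg : G.IsRegularOfDegree (q + 1))
    (hq : q ≠ 0) (hr0 : 0 < r) (hr1 : r < 1) (hh : IsStepHarm q ω r h)
    (h0 : ∀ n v, Occurs G v₀ n v → 0 ≤ h n v) (h1 : ∀ n v, Occurs G v₀ n v → h n v ≤ 1)
    {n : ℕ} {v : V} (hv : Occurs G v₀ n v) : h (n + 2) v ≤ h n v := by
  have hG := hreg.exists_adj
  have hq' : (0 : ℝ) < q := Nat.cast_pos.2 (Nat.pos_of_ne_zero hq)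
  set B := (1 - r) / q with hB
  have hB0 : 0 < B := div_pos (by linarith) hq'
  have hB1 : B ≤ 1 := by
    rw [hB, div_le_one hq']
    have : (1 : ℝ) ≤ q := Nat.one_le_cast.2 (Nat.pos_of_ne_zero hq)
    linarith
  by_contra! hlt
  set S : Set ℝ := {d | ∃ n v, Occurs G v₀ n v ∧ d = h (n + 2) v - h n v} with hS
  have hbdd : BddAbove S := ⟨1, by
    rintro _ ⟨n, v, hv, rfl⟩
    linarith [h0 n v hv, h1 _ v (hv.add_two hG)]⟩
  set s := sSup S
  have hle : ∀ n v, Occurs G v₀ n v → h (n + 2) v - h n v ≤ s := fun n v hv =>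
    le_csSup hbdd ⟨n, v, hv, rfl⟩
  have hs : 0 < s := (sub_pos.2 hlt).trans_le (hle n v hv)
  -- The defect `s - (increment)` is nonnegative and harmonic, so each single term bounds the
  -- average from below.
  have hstep : ∀ n v w, Occurs G v₀ n v → G.Adj v w →
      stepProb q ω r v w * (s - (h (n + 3) w - h (n + 1) w)) ≤ s - (h (n + 2) v - h n v) := by
    intro n v w hv hw
    have e : s - (h (n + 2) v - h n v) =
        ∑ w ∈ G.neighborFinset v, stepProb q ω r v w * (s - (h (n + 3) w - h (n + 1) w)) := by
      rw [hh n v hv, hh (n + 2) v (hv.add_two hG)]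
      simp only [mul_sub, Finset.sum_sub_distrib, ← Finset.sum_mul]
      rw [hT.sum_stepProb hreg hq, one_mul]
    rw [e]
    refine Finset.single_le_sum (f := fun w => stepProb q ω r v w *
      (s - (h (n + 3) w - h (n + 1) w))) (fun u hu => ?_) (by simpa using hw)
    exact mul_nonneg (stepProb_nonneg ⟨hr0.le, hr1.le⟩ _ _)
      (sub_nonneg.2 (hle (n + 1) u (hv.succ hG (by simpa using hu))))
  -- The probability of one step towards `ω` followed by the step back.
  set p := r * B with hp
  have hp0 : 0 < p := mul_pos hr0 hB0
  have hp1 : p ≤ 1 := mul_le_one₀ hr1.le hB0.le hB1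
  have htwo : ∀ n v, Occurs G v₀ n v →
      p * (s - (h (n + 4) v - h (n + 2) v)) ≤ s - (h (n + 2) v - h n v) := by
    intro n v hv
    obtain ⟨w, hw, hl⟩ := hT.exists_leadsTowards ω v
    have e1 := hstep n v w hv hw
    have e2 := hstep (n + 1) w v (hv.succ hG hw) hw.symm
    rw [stepProb_of_leadsTowards hl] at e1
    rw [stepProb_of_not_leadsTowards hl.not_symm] at e2
    calc p * (s - (h (n + 4) v - h (n + 2) v))
        = r * (B * (s - (h (n + 4) v - h (n + 2) v))) := by rw [hp, mul_assoc]
      _ ≤ r * (s - (h (n + 3) w - h (n + 1) w)) := mul_le_mul_of_nonneg_left e2 hr0.le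
      _ ≤ _ := e1
  -- `K` increments of size `s / 2` exceed `1`. A starting defect below `p ^ K * (s / 2)` stays at
  -- most `s / 2` through `K` returns.
  obtain ⟨K, hK⟩ := exists_nat_gt (2 / s)
  rw [div_lt_iff₀ hs] at hK
  obtain ⟨_, ⟨n, v, hv, rfl⟩, hnear⟩ : ∃ d ∈ S, s - p ^ K * (s / 2) < d :=
    exists_lt_of_lt_csSup ⟨_, n, v, hv, rfl⟩ (by
      have := mul_pos (pow_pos hp0 K) (half_pos hs)
      linarith)
  have hiter : ∀ k, p ^ k * (s - (h (n + 2 * k + 2) v - h (n + 2 * k) v)) ≤ p ^ K * (s / 2) := by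
    intro k
    induction k with
    | zero => simp only [pow_zero, mul_zero, add_zero, one_mul]; linarith
    | succ k ih =>
      refine le_trans ?_ ih
      rw [pow_succ, mul_assoc]
      exact mul_le_mul_of_nonneg_left (htwo _ v (hv.add_two_mul hG k)) (pow_pos hp0 k).le
  have hhalf : ∀ k ≤ K, s / 2 ≤ h (n + 2 * k + 2) v - h (n + 2 * k) v := by
    intro k hk
    have h2 : p ^ K * (s / 2) ≤ p ^ k * (s / 2) :=
      mul_le_mul_of_nonneg_right (pow_le_pow_of_le_one hp0.le hp1 hk) (half_pos hs).le
    have := le_of_mul_le_mul_left ((hiter k).trans h2) (pow_pos hp0 k)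
    linarith
  have hsum : ∀ k ≤ K, k * (s / 2) ≤ h (n + 2 * k) v - h n v := by
    intro k
    induction k with
    | zero => simp
    | succ k ih =>
      intro hk
      have e1 := ih (by omega)
      have e2 := hhalf k (by omega)
      rw [show n + 2 * (k + 1) = n + 2 * k + 2 by ring]
      push_cast
      linarith
  have := hsum K le_rfl
  linarith [h0 n v hv, h1 _ v (hv.add_two_mul hG K)]

/-- A drop of `k` towards `ω` must be compensated by the other neighbours, which carry total
probability at most `1/2`; so some neighbour away from `ω` exceeds `v` by at least `k`. The edge
from it to `v` has the same drop, and iteration makes `h` unbounded. -/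
theorem IsStepHarm.le_of_leadsTowards (hT : G.IsTree) (hreg : G.IsRegularOfDegree (q + 1))
    (hq : q ≠ 0) (hr0 : 1 / 2 ≤ r) (hr1 : r < 1) (hh : IsStepHarm q ω r h)
    (h1 : ∀ n v, Occurs G v₀ n v → h n v ≤ 1)
    (hper : ∀ n v, Occurs G v₀ n v → h (n + 2) v = h n v)
    {n : ℕ} {v w : V} (hv : Occurs G v₀ n v) (hw : G.Adj v w) (hl : LeadsTowards ω v w) :
    h n v ≤ h (n + 1) w := by
  classical
  have hG := hreg.exists_adj
  have hq' : (0 : ℝ) < q := Nat.cast_pos.2 (Nat.pos_of_ne_zero hq)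
  by_contra! hlt
  set k := h n v - h (n + 1) w with hk
  have hk0 : 0 < k := sub_pos.2 hlt
  have key : ∀ j : ℕ, ∃ n' v' w', Occurs G v₀ n' v' ∧ G.Adj v' w' ∧ LeadsTowards ω v' w' ∧
      k ≤ h n' v' - h (n' + 1) w' ∧ h n v + j * k ≤ h n' v' := by
    intro j
    induction j with
    | zero => exact ⟨n, v, w, hv, hw, hl, le_rfl, by simp⟩
    | succ j ih =>
      obtain ⟨n', v', w', hv', hw', hl', hk', hj⟩ := ih
      obtain ⟨u, hu, huw, huk⟩ : ∃ u, G.Adj v' u ∧ u ≠ w' ∧ k ≤ h (n' + 1) u - h n' v' := by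
        by_contra! hcon
        have e := hh n' v' hv'
        rw [hT.sum_stepProb_mul hw' hl'] at e
        have hw'' : w' ∈ G.neighborFinset v' := by simpa using hw'
        have hcard : ((G.neighborFinset v').erase w').card = q := by
          rw [Finset.card_erase_of_mem hw'', card_neighborFinset_eq_degree, hreg v']
          rfl
        rw [← Finset.add_sum_erase _ _ hw'', add_sub_cancel_left] at e
        have hlt' : ∑ u ∈ (G.neighborFinset v').erase w', h (n' + 1) u ≤ q * (h n' v' + k) := by
          rw [← hcard, ← nsmul_eq_mul, ← Finset.sum_const]
          refine Finset.sum_le_sum fun u hu => ?_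
          rw [Finset.mem_erase, mem_neighborFinset] at hu
          linarith [hcon u hu.2 hu.1]
        have hlt'' : ∑ u ∈ (G.neighborFinset v').erase w', h (n' + 1) u < q * (h n' v' + k) := by
          have : ((G.neighborFinset v').erase w').Nonempty := by
            rw [← Finset.card_pos, hcard]; exact Nat.pos_of_ne_zero hq
          rw [← hcard, ← nsmul_eq_mul, ← Finset.sum_const]
          refine Finset.sum_lt_sum_of_nonempty this fun u hu => ?_
          rw [Finset.mem_erase, mem_neighborFinset] at hu
          linarith [hcon u hu.2 hu.1]
        have e2 := mul_lt_mul_of_pos_left hlt'' (div_pos (show 0 < 1 - r by linarith) hq')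
        have e3 : (1 - r) / q * (q * (h n' v' + k)) = (1 - r) * (h n' v' + k) := by
          field_simp
        -- The estimates combine to `h < h + (1 - 2r) k`, absurd for `r ≥ 1/2`.
        nlinarith
      have hlu : LeadsTowards ω u v' := (hT.leadsTowards_or ω hu).resolve_left fun h' =>
        huw (hT.leadsTowards_unique hu hw' h' hl')
      refine ⟨n' + 1, u, v', hv'.succ hG hu, hu.symm, hlu, ?_, ?_⟩
      · rw [hper n' v' hv']
        exact huk
      · push_cast
        linarith
  obtain ⟨j, hj⟩ := exists_nat_gt ((1 - h n v) / k)
  rw [div_lt_iff₀ hk0] at hj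
  obtain ⟨n', v', -, hv', -, -, -, hj'⟩ := key j
  linarith [h1 n' v' hv']

/-- The Liouville property of the random walk with parameters `ω` and `1/2 ≤ r < 1`. -/
theorem IsStepHarm.eq_const (hT : G.IsTree) (hreg : G.IsRegularOfDegree (q + 1))
    (hq : q ≠ 0) (hr0 : 1 / 2 ≤ r) (hr1 : r < 1) (hh : IsStepHarm q ω r h)
    (h0 : ∀ n v, Occurs G v₀ n v → 0 ≤ h n v) (h1 : ∀ n v, Occurs G v₀ n v → h n v ≤ 1)
    (x : (G.pascalization v₀).Path) (n : ℕ) : h n (pos x n) = h 0 v₀ := by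
  have hh' := hh.one_sub hT hreg hq
  have h0' : ∀ n v, Occurs G v₀ n v → 0 ≤ 1 - h n v := fun n v hv => sub_nonneg.2 (h1 n v hv)
  have h1' : ∀ n v, Occurs G v₀ n v → 1 - h n v ≤ 1 := fun n v hv => by linarith [h0 n v hv]
  have hper : ∀ n v, Occurs G v₀ n v → h (n + 2) v = h n v := fun n v hv => by
    have e1 := hh.apply_add_two_le hT hreg hq (by linarith) hr1 h0 h1 hv
    have e2 := hh'.apply_add_two_le hT hreg hq (by linarith) hr1 h0' h1' hv
    linarith
  have hpar : ∀ n v w, Occurs G v₀ n v → G.Adj v w → LeadsTowards ω v w → h n v = h (n + 1) w := by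
    intro n v w hv hw hl
    have e1 := hh.le_of_leadsTowards hT hreg hq hr0 hr1 h1 hper hv hw hl
    have e2 := hh'.le_of_leadsTowards hT hreg hq hr0 hr1 h1'
      (fun n v hv => by rw [hper n v hv]) hv hw hl
    linarith
  induction n with
  | zero => rw [pos_zero]
  | succ n ih =>
    rw [← ih]
    rcases hT.leadsTowards_or ω (pos_adj x n) with hl | hl
    · exact (hpar n _ _ (occurs_pos x n) (pos_adj x n) hl).symm
    · rw [hpar (n + 1) _ _ (occurs_pos x (n + 1)) (pos_adj x n).symm hl,
        hper n _ (occurs_pos x n)]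

end Bounded

theorem isErgodic_of_measure_cyl_eq_one {μ : ProbabilityMeasure (G.pascalization v₀).Path}
    {x : (G.pascalization v₀).Path}
    (h : ∀ n, (μ : Measure (G.pascalization v₀).Path) (Cyl n x) = 1) :
    GradedGraph.IsErgodic μ := by
  have hae : ∀ᵐ y ∂(μ : Measure (G.pascalization v₀).Path), y = x := by
    have : ∀ᵐ y ∂(μ : Measure (G.pascalization v₀).Path), ∀ n, y ∈ Cyl n x :=
      ae_all_iff.2 fun n => (mem_ae_iff_prob_eq_one (measurableSet_cyl n x)).2 (h n)
    filter_upwards [this] with y hy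
    exact path_ext fun n => hy n n le_rfl
  intro A hA
  have hA' : MeasurableSet A := (MeasurableSpace.measurableSet_iInf.1 hA 0).1
  by_cases hx : x ∈ A
  · right
    exact (mem_ae_iff_prob_eq_one hA').1 (hae.mono fun y hy => hy ▸ hx)
  · left
    exact measure_eq_zero_iff_ae_notMem.2 (hae.mono fun y hy => hy ▸ hx)

section Lambda

variable {q : ℕ} {ω : G.TreeBoundary v₀} {r : ℝ}

theorem IsLambda.segMass_succ (hT : G.IsTree) (hG : ∀ v, ∃ w, G.Adj v w)
    {μ : ProbabilityMeasure (G.pascalization v₀).Path} (h : IsLambda q ω r μ) {n : ℕ} {v w : V}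
    (hv : Occurs G v₀ n v) (hw : G.Adj v w) :
    segMass (μ : Measure (G.pascalization v₀).Path) (n + 1) w =
      segMass (μ : Measure (G.pascalization v₀).Path) n v * stepProb q ω r v w := by
  obtain ⟨x, rfl⟩ := hv
  obtain ⟨y, hy, rfl⟩ := exists_mem_cyl_pos_succ hG x n hw
  rw [← hy n le_rfl, (h.isInv hT hG).segMass_pos, (h.isInv hT hG).segMass_pos,
    (isLambda_iff hG).1 h, (isLambda_iff hG).1 h, Finset.prod_range_succ]

theorem IsLambda.segMass_ne_zero (hT : G.IsTree) (hG : ∀ v, ∃ w, G.Adj v w) (hq : q ≠ 0)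
    (hr0 : 0 < r) (hr1 : r < 1) {μ : ProbabilityMeasure (G.pascalization v₀).Path}
    (h : IsLambda q ω r μ) {n : ℕ} {v : V} (hv : Occurs G v₀ n v) :
    segMass (μ : Measure (G.pascalization v₀).Path) n v ≠ 0 := by
  obtain ⟨x, rfl⟩ := hv
  rw [(h.isInv hT hG).segMass_pos, (isLambda_iff hG).1 h]
  refine Finset.prod_ne_zero_iff.2 fun k _ => ?_
  unfold stepProb
  split
  · exact hr0.ne'
  · exact div_ne_zero (by linarith) (Nat.cast_ne_zero.2 hq)

/-- For `r = 1` the measure sits on the ray `ω`. Otherwise the Liouville property makes the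
conditional probability of a tail event constant, so the event is independent of every cylinder and
hence of itself. -/
theorem IsLambda.isErgodic (hT : G.IsTree) (hreg : G.IsRegularOfDegree (q + 1)) (hq : q ≠ 0)
    (hr : r ∈ Set.Icc (1 / 2 : ℝ) 1) {μ : ProbabilityMeasure (G.pascalization v₀).Path}
    (h : IsLambda q ω r μ) : GradedGraph.IsErgodic μ := by
  have hG := hreg.exists_adj
  rcases hr.2.eq_or_lt with rfl | hr1
  · refine isErgodic_of_measure_cyl_eq_one (x := mkPath ω.1 ω.2.1 ω.2.2.1) fun n => ?_
    have e := (isLambda_iff hG).1 h n (mkPath ω.1 ω.2.1 ω.2.2.1)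
    rw [Finset.prod_eq_one fun k _ => by
      rw [pos_mkPath, pos_mkPath, stepProb_of_leadsTowards (hT.leadsTowards_ray ω k)]] at e
    rwa [Measure.real, ENNReal.toReal_eq_one_iff] at e
  · intro A hA
    set m : Measure (G.pascalization v₀).Path := (μ : Measure (G.pascalization v₀).Path) with hm
    have hA' : MeasurableSet A := (MeasurableSpace.measurableSet_iInf.1 hA 0).1
    have hinv : IsInv m := h.isInv hT hG
    have hinvA : IsInv (m.restrict A) := hinv.restrict hG hA
    have hne : ∀ {n v}, Occurs G v₀ n v → segMass m n v ≠ 0 := fun hv =>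
      h.segMass_ne_zero hT hG hq (by linarith [hr.1]) hr1 hv
    -- The conditional probability of `A` given that the path is at `v` at time `n`.
    set f : ℕ → V → ℝ := fun n v => segMass (m.restrict A) n v / segMass m n v with hf
    have hfm : ∀ {n v}, Occurs G v₀ n v → f n v * segMass m n v = segMass (m.restrict A) n v :=
      fun hv => div_mul_cancel₀ _ (hne hv)
    have hstep : IsStepHarm q ω r f := by
      intro n v hv
      refine mul_right_cancel₀ (hne hv) ?_
      have hv' := hv
      rw [hfm hv]
      obtain ⟨x, rfl⟩ := hv
      rw [hinvA.isHarm hG x n, Finset.sum_mul]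
      refine Finset.sum_congr rfl fun w hw => ?_
      have hw' : G.Adj (pos x n) w := by simpa using hw
      rw [← hfm (hv'.succ hG hw'), h.segMass_succ hT hG hv' hw']
      ring
    have h0 : ∀ n v, Occurs G v₀ n v → 0 ≤ f n v := fun n v _ =>
      div_nonneg (segMass_nonneg n v) (segMass_nonneg n v)
    have h1 : ∀ n v, Occurs G v₀ n v → f n v ≤ 1 := by
      rintro n _ ⟨x, rfl⟩
      refine div_le_one_of_le₀ ?_ (segMass_nonneg n _)
      rw [hinv.segMass_pos, hinvA.segMass_pos, Measure.real, Measure.real]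
      exact ENNReal.toReal_mono (measure_ne_top _ _) (Measure.restrict_apply_le _ _)
    have hconst := hstep.eq_const hT hreg hq hr.1 hr1 h0 h1
    have heq : m.restrict A = m A • m := by
      have : IsFiniteMeasure (m A • m) := Measure.smul_finite _ (measure_ne_top _ _)
      refine measure_ext_cyl hG 0 fun n _ x => ?_
      rw [← ENNReal.toReal_eq_toReal_iff' (measure_ne_top _ _) (measure_ne_top _ _)]
      have e1 := hfm (occurs_pos x n)
      have e2 := hfm (occurs_pos x 0)
      rw [hconst, hinv.segMass_pos, hinvA.segMass_pos] at e1
      rw [hconst, hinv.segMass_pos, hinvA.segMass_pos, cyl_zero, probReal_univ, mul_one,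
        Measure.real, Measure.restrict_apply_univ] at e2
      rw [e2] at e1
      simpa [Measure.real] using e1.symm
    have e := congrArg (fun ν : Measure (G.pascalization v₀).Path => ν A) heq
    simp only [Measure.restrict_apply_self, Measure.smul_apply, smul_eq_mul] at e
    by_cases hz : m A = 0
    · exact Or.inl hz
    · right
      exact ((ENNReal.mul_eq_left hz (measure_ne_top _ _)).1 e.symm)

end Lambda

end SimpleGraph

/-! ### Positive eigenfunctions of the adjacency operator. -/

namespace SimpleGraph

variable {V : Type u} {G : SimpleGraph V} {v₀ : V}

/-- The edge inequality is iterated along a geodesic. -/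
theorem pow_dist_mul_le (hT : G.IsTree) {ψ : V → ℝ} {F : ℝ} (hF0 : 0 ≤ F)
    (hF : ∀ u v, G.Adj u v → F * ψ u ≤ ψ v) (u v : V) : F ^ G.dist v u * ψ u ≤ ψ v := by
  induction hd : G.dist v u generalizing v with
  | zero => rw [(hT.connected.dist_eq_zero_iff).1 hd, pow_zero, one_mul]
  | succ d ih =>
    have hne : v ≠ u := by rintro rfl; simp at hd
    obtain ⟨w, hw, hdw⟩ := hT.exists_adj_dist_eq_add_one hne
    calc F ^ (d + 1) * ψ u = F * (F ^ d * ψ u) := by ring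
      _ ≤ F * ψ w := mul_le_mul_of_nonneg_left (ih w (by omega)) hF0
      _ ≤ ψ v := hF w v hw.symm

variable [G.LocallyFinite] {q : ℕ} {ψ : V → ℝ} {l F : ℝ}

/-- A nonnegative eigenfunction that does not vanish at a vertex is positive. -/
theorem eigenfunction_pos (hconn : G.Connected) (h0 : ∀ v, 0 ≤ ψ v)
    (hψ : ∀ v, ∑ w ∈ G.neighborFinset v, ψ w = l * ψ v) (hv₀ : 0 < ψ v₀) (v : V) : 0 < ψ v := by
  have hr := (reachable_iff_reflTransGen v₀ v).1 (hconn v₀ v)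
  induction hr with
  | refl => exact hv₀
  | @tail v w _ hvw ih =>
    refine (h0 w).lt_of_ne fun hw => ?_
    have e := hψ w
    rw [← hw, mul_zero, Finset.sum_eq_zero_iff_of_nonneg fun u _ => h0 u] at e
    exact ih.ne' (e v (by simpa using hvw.symm))

/-- A positive eigenfunction of the adjacency operator of the `(q + 1)`-regular tree has eigenvalue
at least `2√q` and satisfies the Harnack inequality with the corresponding constant `F`. -/
theorem IsRegularOfDegree.exists_harnack (hreg : G.IsRegularOfDegree (q + 1)) (hq : q ≠ 0) (v₀ : V)
    (hpos : ∀ v, 0 < ψ v) (hψ : ∀ v, ∑ w ∈ G.neighborFinset v, ψ w = l * ψ v) :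
    ∃ F : ℝ, 0 < F ∧ q * F ^ 2 + 1 = l * F ∧ q * F ^ 2 ≤ 1 ∧ ∀ u v, G.Adj u v → F * ψ u ≤ ψ v := by
  classical
  have hq' : (0 : ℝ) < q := Nat.cast_pos.2 (Nat.pos_of_ne_zero hq)
  set S : Set ℝ := {d | ∃ u v, G.Adj u v ∧ d = ψ v / ψ u}
  have hbdd : BddBelow S := ⟨0, by
    rintro _ ⟨u, v, -, rfl⟩
    exact (div_pos (hpos v) (hpos u)).le⟩
  have hne : S.Nonempty := by
    obtain ⟨w, hw⟩ := hreg.exists_adj v₀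
    exact ⟨_, v₀, w, hw, rfl⟩
  -- The best constant in the Harnack inequality.
  set b := sInf S
  have hb0 : 0 ≤ b := le_csInf hne (by
    rintro _ ⟨u, v, -, rfl⟩
    exact (div_pos (hpos v) (hpos u)).le)
  have hb : ∀ u v, G.Adj u v → b * ψ u ≤ ψ v := fun u v h =>
    (le_div_iff₀ (hpos u)).1 (csInf_le hbdd ⟨u, v, h, rfl⟩)
  -- In the eigenvalue equation at `v`, the `q` neighbours other than `u` are bounded below by `b
  -- ψ(v)`.
  have hkey : ∀ u v, G.Adj u v → ψ u ≤ (l - q * b) * ψ v := by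
    intro u v huv
    have hu : u ∈ G.neighborFinset v := by simpa using huv.symm
    have e := hψ v
    rw [← Finset.add_sum_erase _ _ hu] at e
    have hcard : ((G.neighborFinset v).erase u).card = q := by
      rw [Finset.card_erase_of_mem hu, card_neighborFinset_eq_degree, hreg v]
      rfl
    have h2 : q * (b * ψ v) ≤ ∑ w ∈ (G.neighborFinset v).erase u, ψ w := by
      rw [← hcard, ← nsmul_eq_mul, ← Finset.sum_const]
      refine Finset.sum_le_sum fun w hw => hb v w ?_
      simpa using (Finset.mem_erase.1 hw).2
    linarith
  have hlq : 0 < l - q * b := by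
    obtain ⟨w, hw⟩ := hreg.exists_adj v₀
    exact pos_of_mul_pos_left ((hpos _).trans_le (hkey v₀ w hw)) (hpos w).le
  have hb1 : 1 ≤ b * (l - q * b) := by
    rw [← div_le_iff₀ hlq]
    refine le_csInf hne ?_
    rintro _ ⟨u, v, huv, rfl⟩
    rw [div_le_div_iff₀ hlq (hpos u), one_mul, mul_comm]
    exact hkey u v huv
  -- The bootstrapped bound says `q b² - l b + 1 ≤ 0`. So the roots are real and `b` is at least the
  -- smaller one, `F`; as the product of the roots is `1/q`, also `q F² ≤ 1`.
  set D := l ^ 2 - 4 * q with hD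
  have hDb : (l - 2 * q * b) ^ 2 ≤ D := by rw [hD]; nlinarith
  have hD0 : 0 ≤ D := (sq_nonneg _).trans hDb
  have hl : 0 < l := by nlinarith
  set s := √D
  have hs2 : s ^ 2 = D := Real.sq_sqrt hD0
  have hs0 : 0 ≤ s := Real.sqrt_nonneg D
  have hsl : s < l := by nlinarith
  have hFb : (l - s) / (2 * q) ≤ b := by
    rw [div_le_iff₀ (by positivity)]
    have := Real.le_sqrt_of_sq_le hDb
    linarith
  refine ⟨(l - s) / (2 * q), by apply div_pos <;> linarith, ?_, ?_, fun u v h => ?_⟩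
  · field_simp
    nlinarith
  · rw [div_pow, mul_pow, mul_div_assoc', div_le_one (by positivity)]
    have : (l - s) ^ 2 ≤ 4 * q := by nlinarith
    nlinarith
  · exact (mul_le_mul_of_nonneg_right hFb (hpos u).le).trans (hb u v h)

/-- An extreme positive eigenfunction grows or decays at the extreme rate along every edge. -/
theorem IsTree.eigenfunction_edge (hT : G.IsTree) (hreg : G.IsRegularOfDegree (q + 1))
    (hF0 : 0 < F) (hF1 : F < 1) (hF : q * F ^ 2 + 1 = l * F)
    (hψ : ∀ v, ∑ w ∈ G.neighborFinset v, ψ w = l * ψ v)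
    (hle : ∀ u v, G.Adj u v → F * ψ u ≤ ψ v)
    (hext : ∀ ψ' : V → ℝ, (∀ v, 0 ≤ ψ' v) → (∀ v, ψ' v ≤ ψ v) →
      (∀ v, ∑ w ∈ G.neighborFinset v, ψ' w = l * ψ' v) → ∃ t, ∀ v, ψ' v = t * ψ v)
    {a b : V} (hab : G.Adj a b) : ψ b = F * ψ a ∨ ψ a = F * ψ b := by
  classical
  have hF2 : 0 < 1 - F ^ 2 := by nlinarith
  -- On the edge, `ψ` is written as `κ F^{d(·,b)} + κ' F^{d(·,a)}`; Harnack in both directions makes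
  -- the coefficients nonnegative.
  obtain ⟨κ, κ', hb, ha⟩ : ∃ κ κ' : ℝ, ψ b = κ + F * κ' ∧ ψ a = κ' + F * κ :=
    ⟨(ψ b - F * ψ a) / (1 - F ^ 2), (ψ a - F * ψ b) / (1 - F ^ 2),
      by field_simp; ring, by field_simp; ring⟩
  have hκ : 0 ≤ κ := by
    have := hle a b hab
    refine nonneg_of_mul_nonneg_left (b := 1 - F ^ 2) ?_ hF2
    nlinarith
  have hκ' : 0 ≤ κ' := by
    have := hle b a hab.symm
    refine nonneg_of_mul_nonneg_left (b := 1 - F ^ 2) ?_ hF2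
    nlinarith
  have hκb : κ ≤ ψ b := by nlinarith
  have hκa : κ' ≤ ψ a := by nlinarith
  have hdab : G.dist a b = 1 := dist_eq_one_iff_adj.2 hab
  have hdba : G.dist b a = 1 := dist_eq_one_iff_adj.2 hab.symm
  -- On the side of `b` the contribution of `a` is removed; on the side of `a` only that of `b` is
  -- kept. By the choice of `κ`, `κ'` the two formulas agree at both `a` and `b`, and each power of
  -- `F` is used only away from its pole, so `ψ'` is an eigenfunction.
  set ψ' : V → ℝ := fun v =>
    if G.dist v a = G.dist v b + 1 then ψ v - κ' * F ^ G.dist v a else κ * F ^ G.dist v b with hψ'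
  have hin : ∀ {v}, G.dist v a = G.dist v b + 1 → ψ' v = ψ v - κ' * F ^ G.dist v a :=
    fun h => if_pos h
  have hout : ∀ {v}, ¬ G.dist v a = G.dist v b + 1 → ψ' v = κ * F ^ G.dist v b :=
    fun h => if_neg h
  have hout' : ∀ {v}, ¬ G.dist v a = G.dist v b + 1 → G.dist v b = G.dist v a + 1 :=
    fun h => (hT.dist_eq_dist_add_one_of_adj _ hab).resolve_left h
  have hψ'a : ψ' a = F * κ := by
    rw [hout (by rw [dist_self, hdab]; omega), hdab]
    ring
  have hψ'b : ψ' b = κ := by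
    rw [hin (by rw [dist_self, hdba]), hdba]
    linarith
  have hupa : ∀ v, κ' * F ^ G.dist v a ≤ ψ v := fun v => by
    refine le_trans ?_ (pow_dist_mul_le hT hF0.le hle a v)
    rw [mul_comm]
    exact mul_le_mul_of_nonneg_left hκa (pow_nonneg hF0.le _)
  have hupb : ∀ v, κ * F ^ G.dist v b ≤ ψ v := fun v => by
    refine le_trans ?_ (pow_dist_mul_le hT hF0.le hle b v)
    rw [mul_comm]
    exact mul_le_mul_of_nonneg_left hκb (pow_nonneg hF0.le _)
  obtain ⟨t, ht⟩ := hext ψ' (fun v => by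
      by_cases h : G.dist v a = G.dist v b + 1
      · rw [hin h]; linarith [hupa v]
      · rw [hout h]; positivity) (fun v => by
      by_cases h : G.dist v a = G.dist v b + 1
      · rw [hin h]
        have := mul_nonneg hκ' (pow_nonneg hF0.le (G.dist v a))
        linarith
      · rw [hout h]; exact hupb v) (fun v => by
      by_cases h : G.dist v a = G.dist v b + 1
      · have hnb : ∀ w ∈ G.neighborFinset v, ψ' w = ψ w - κ' * F ^ G.dist w a := fun w hw => by
          by_cases hw' : G.dist w a = G.dist w b + 1
          · exact hin hw'
          · obtain ⟨rfl, rfl⟩ := hT.eq_and_eq_of_adj_of_dist_eq_add_one hab (by simpa using hw) h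
              (hout' hw')
            rw [hψ'a, dist_self]
            linarith
        have hva : v ≠ a := by rintro rfl; simp at h
        rw [Finset.sum_congr rfl hnb, Finset.sum_sub_distrib, hψ, ← Finset.mul_sum,
          hT.sum_pow_dist hreg hva hF, hin h]
        ring
      · have hnb : ∀ w ∈ G.neighborFinset v, ψ' w = κ * F ^ G.dist w b := fun w hw => by
          by_cases hw' : G.dist w a = G.dist w b + 1
          · obtain ⟨rfl, rfl⟩ := hT.eq_and_eq_of_adj_of_dist_eq_add_one hab
              (show G.Adj w v from (by simpa using hw : G.Adj v w).symm) hw' (hout' h)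
            rw [hψ'b, dist_self, pow_zero, mul_one]
          · exact hout hw'
        have hvb : v ≠ b := by
          rintro rfl
          have := hout' h
          simp at this
        rw [Finset.sum_congr rfl hnb, ← Finset.mul_sum, hT.sum_pow_dist hreg hvb hF, hout h]
        ring)
  -- Since `ψ' a = F * ψ' b`, proportionality transfers this ratio to `ψ` unless `κ = 0`, in which
  -- case `ψ b = F * ψ a`.
  have ea := ht a
  have eb := ht b
  rw [hψ'a] at ea
  rw [hψ'b] at eb
  rcases hκ.eq_or_lt with h | h
  · left
    rw [hb, ha, ← h]
    ring
  · right
    have ht0 : t ≠ 0 := by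
      rintro rfl
      rw [zero_mul] at eb
      exact h.ne' eb
    refine mul_left_cancel₀ ht0 ?_
    rw [← ea, eb]
    ring

/-- A positive eigenfunction that grows or decays at the extreme rate along every edge is the Martin
kernel of a boundary point. -/
theorem IsTree.exists_treeBoundary_of_edge (hT : G.IsTree) (hreg : G.IsRegularOfDegree (q + 1))
    (hF0 : 0 < F) (hF1 : F < 1) (hF : q * F ^ 2 + 1 = l * F) (hpos : ∀ v, 0 < ψ v)
    (hψ : ∀ v, ∑ w ∈ G.neighborFinset v, ψ w = l * ψ v)
    (hle : ∀ u v, G.Adj u v → F * ψ u ≤ ψ v)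
    (hedge : ∀ a b, G.Adj a b → ψ b = F * ψ a ∨ ψ a = F * ψ b) (v₀ : V) :
    ∃ ω : G.TreeBoundary v₀, ∀ v w, G.Adj v w →
      (LeadsTowards ω v w → ψ v = F * ψ w) ∧ (¬ LeadsTowards ω v w → ψ w = F * ψ v) := by
  classical
  have hF2 : F * F < 1 := by nlinarith
  -- If all neighbours carried the factor `F`, then `l = (q + 1) F` and `F² = 1`. Once one neighbour
  -- carries `1/F`, the eigenvalue equation forces equality in Harnack for the other `q`.
  have hpar : ∀ v, ∃ w, G.Adj v w ∧ ψ v = F * ψ w ∧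
      ∀ u, G.Adj v u → u ≠ w → ψ u = F * ψ v := by
    intro v
    obtain ⟨w, hw, hvw⟩ : ∃ w, G.Adj v w ∧ ψ v = F * ψ w := by
      by_contra! hcon
      have e := hreg.sum_neighborFinset_const v (f := ψ) (y := F * ψ v) fun u hu =>
        (hedge v u hu).resolve_right (hcon u hu)
      rw [hψ] at e
      have e2 : l = (q + 1) * F := mul_right_cancel₀ (hpos v).ne' (by linarith)
      rw [e2] at hF
      nlinarith
    refine ⟨w, hw, hvw, fun u hu hne => ?_⟩
    have hw' : w ∈ G.neighborFinset v := by simpa using hw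
    have hcard : ((G.neighborFinset v).erase w).card = q := by
      rw [Finset.card_erase_of_mem hw', card_neighborFinset_eq_degree, hreg v]
      rfl
    have e := hψ v
    rw [← Finset.add_sum_erase _ _ hw'] at e
    have e1 : ∑ u ∈ (G.neighborFinset v).erase w, F * ψ v =
        ∑ u ∈ (G.neighborFinset v).erase w, ψ u := by
      rw [Finset.sum_const, hcard, nsmul_eq_mul]
      rw [hvw] at e ⊢
      linear_combination -e + ψ w * hF
    have e2 := (Finset.sum_eq_sum_iff_of_le fun u hu => hle v u (by
      simpa using (Finset.mem_erase.1 hu).2)).1 e1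
    exact (e2 u (Finset.mem_erase.2 ⟨hne, by simpa using hu⟩)).symm
  choose P hP hP1 hP2 using hpar
  set f : ℕ → V := fun n => P^[n] v₀ with hf
  have hfs : ∀ n, f (n + 1) = P (f n) := fun n => Function.iterate_succ_apply' P n v₀
  -- Climbing `ψ` yields the ray; strict growth prevents repeated vertices.
  have hmono : StrictMono fun n => ψ (f n) := strictMono_nat_of_lt_succ fun n => by
    rw [hP1 (f n), hfs]
    have := hpos (P (f n))
    nlinarith
  let ω : G.TreeBoundary v₀ := ⟨f, rfl, fun n => by rw [hfs]; exact hP _,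
    fun m n h => hmono.injective (congrArg ψ h)⟩
  have hωf : ∀ n, ω.1 n = f n := fun _ => rfl
  -- Equality in the iterated Harnack inequality along the geodesic from `v` to `ω n` forces
  -- equality on its first edge and on the rest.
  have hcase : ∀ v w, G.Adj v w → LeadsTowards ω v w →
      (∀ᶠ n in atTop, ψ v = F ^ G.dist v (ω.1 n) * ψ (ω.1 n)) →
      ψ v = F * ψ w ∧ ∀ᶠ n in atTop, ψ w = F ^ G.dist w (ω.1 n) * ψ (ω.1 n) := by
    intro v w hvw hl hv
    have key : ∀ᶠ n in atTop, ψ v = F * ψ w ∧ ψ w = F ^ G.dist w (ω.1 n) * ψ (ω.1 n) := by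
      filter_upwards [hl, hv] with n h1 h2
      rw [h1, pow_succ'] at h2
      have h3 := hle w v hvw.symm
      have h4 := pow_dist_mul_le hT hF0.le hle (ω.1 n) w
      have h5 : ψ w ≤ F ^ G.dist w (ω.1 n) * ψ (ω.1 n) := by
        rw [h2, mul_assoc] at h3
        exact le_of_mul_le_mul_left h3 hF0
      have h6 := le_antisymm h5 h4
      exact ⟨by rw [h2, mul_assoc, ← h6], h6⟩
    exact ⟨key.exists.choose_spec.1, key.mono fun n h => h.2⟩
  have hmain : ∀ v, ∀ᶠ n in atTop, ψ v = F ^ G.dist v (ω.1 n) * ψ (ω.1 n) := by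
    intro v
    have hr := (reachable_iff_reflTransGen v₀ v).1 (hT.connected v₀ v)
    induction hr with
    | refl =>
      refine Eventually.of_forall fun n => ?_
      rw [hT.dist_treeBoundary]
      induction n with
      | zero => rw [pow_zero, one_mul, ω.2.1]
      | succ n ih => rw [ih, hωf, hωf, hP1 (f n), hfs]; ring
    | @tail v w _ hvw ih =>
      have hvw : G.Adj v w := hvw
      rcases hT.leadsTowards_or ω hvw with hl | hl
      · exact (hcase v w hvw hl ih).2
      · obtain ⟨u, hu, hlu⟩ := hT.exists_leadsTowards ω v
        have h1 := (hcase v u hu hlu ih).1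
        have huP : u = P v := by
          by_contra hne
          have h2 := hP2 v u hu hne
          rw [h2] at h1
          have := hpos v
          nlinarith
        have hwP : w ≠ P v := by
          rintro rfl
          rw [huP] at hlu
          exact hl.not_symm hlu
        have h2 := hP2 v w hvw hwP
        filter_upwards [hl, ih] with n h3 h4
        rw [h2, h4, h3, pow_succ']
        ring
  refine ⟨ω, fun v w hvw => ⟨fun hl => (hcase v w hvw hl (hmain v)).1, fun hl => ?_⟩⟩
  exact (hcase w v hvw.symm ((hT.leadsTowards_or ω hvw).resolve_left hl) (hmain w)).1

end SimpleGraph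

/-! ### Classification of the ergodic central measures. -/

namespace SimpleGraph

variable {V : Type u} {G : SimpleGraph V} {v₀ : V}

/-- The vertices of a geodesic of a tree are determined by their position. -/
theorem IsTree.eq_of_dist_add_dist (hT : G.IsTree) {a b u v : V}
    (hu : G.dist a u + G.dist u b = G.dist a b) (hv : G.dist a v + G.dist v b = G.dist a b)
    (huv : G.dist a u = G.dist a v) : u = v := by
  induction hd : G.dist u b generalizing u v with
  | zero =>
    rw [(hT.connected.dist_eq_zero_iff).1 hd, (hT.connected.dist_eq_zero_iff (u := v) (v := b)).1
      (by omega)]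
  | succ d ih =>
    have step : ∀ z, G.dist a z + G.dist z b = G.dist a b → G.dist z b = d + 1 →
        ∃ z', G.Adj z z' ∧ G.dist z' b = d ∧ G.dist a z' = G.dist a z + 1 := by
      intro z hz hzd
      have hne : z ≠ b := by rintro rfl; simp at hzd
      obtain ⟨z', hz', hd'⟩ := hT.exists_adj_dist_eq_add_one hne
      have h1 := hT.dist_eq_dist_add_one_of_adj a hz'
      have h2 : G.dist a b ≤ G.dist a z' + G.dist z' b := hT.connected.dist_triangle
      exact ⟨z', hz', by omega, by omega⟩
    obtain ⟨u', hu', h1, h2⟩ := step u hu hd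
    obtain ⟨v', hv', h3, h4⟩ := step v hv (by omega)
    have := ih (u := u') (v := v') (by omega) (by omega) (by omega) h1
    subst this
    exact hT.eq_of_adj_of_dist_eq_add_one hu'.symm hv'.symm (b := a)
      (by rw [dist_comm, h2, dist_comm]) (by rw [dist_comm, h4, dist_comm])

variable [G.LocallyFinite]

theorem occurs_zero (hG : ∀ v, ∃ w, G.Adj v w) : Occurs G v₀ 0 v₀ := by
  obtain ⟨x⟩ := nonempty_path (v₀ := v₀) hG
  exact ⟨x, pos_zero x⟩

theorem occurs_dist (hT : G.IsTree) (hG : ∀ v, ∃ w, G.Adj v w) (v : V) :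
    Occurs G v₀ (G.dist v₀ v) v := by
  induction hd : G.dist v₀ v generalizing v with
  | zero => rw [← (hT.connected.dist_eq_zero_iff).1 hd]; exact occurs_zero hG
  | succ d ih =>
    have hne : v ≠ v₀ := by rintro rfl; simp at hd
    obtain ⟨w, hw, hdw⟩ := hT.exists_adj_dist_eq_add_one hne
    rw [dist_comm, dist_comm (u := w)] at hdw
    exact (ih w (by omega)).succ hG hw.symm

section Central

variable {μ : ProbabilityMeasure (G.pascalization v₀).Path}

theorem IsInv.segMass_succ_le (hG : ∀ v, ∃ w, G.Adj v w)
    (h : IsInv (μ : Measure (G.pascalization v₀).Path)) {n : ℕ} {v w : V} (hv : Occurs G v₀ n v)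
    (hw : G.Adj v w) : segMass (μ : Measure (G.pascalization v₀).Path) (n + 1) w ≤
      segMass (μ : Measure (G.pascalization v₀).Path) n v := by
  obtain ⟨x, rfl⟩ := hv
  rw [h.isHarm hG x n]
  exact Finset.single_le_sum (f := fun w => segMass (μ : Measure (G.pascalization v₀).Path) (n + 1) w)
    (fun _ _ => segMass_nonneg _ _) (by simpa using hw)

/-- The shift by two levels is again harmonic, and it is dominated because a detour to a neighbour
and back cannot increase mass; extremality applies. -/
theorem IsInv.segMass_add_two (hG : ∀ v, ∃ w, G.Adj v w)
    (h : IsInv (μ : Measure (G.pascalization v₀).Path)) (herg : GradedGraph.IsErgodic μ) {n : ℕ}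
    {v : V} (hv : Occurs G v₀ n v) :
    segMass (μ : Measure (G.pascalization v₀).Path) (n + 2) v =
      segMass (μ : Measure (G.pascalization v₀).Path) 2 v₀ *
        segMass (μ : Measure (G.pascalization v₀).Path) n v := by
  obtain ⟨x, rfl⟩ := hv
  refine h.eq_mul_segMass hG herg
    (g := fun n v => segMass (μ : Measure (G.pascalization v₀).Path) (n + 2) v)
    (fun y k => ?_) (fun _ _ => segMass_nonneg _ _) (fun y k => ?_) x n
  · obtain ⟨z, hz⟩ := exists_pos_add_two hG y k
    rw [← hz]
    exact h.isHarm hG z (k + 2)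
  · obtain ⟨w, hw⟩ := hG (pos y k)
    exact (h.segMass_succ_le hG ((occurs_pos y k).succ hG hw) hw.symm).trans
      (h.segMass_succ_le hG (occurs_pos y k) hw)

theorem eq_of_measure_cyl_eq_one (hG : ∀ v, ∃ w, G.Adj v w)
    {ν : ProbabilityMeasure (G.pascalization v₀).Path} {x : (G.pascalization v₀).Path}
    (hμ : ∀ n, (μ : Measure (G.pascalization v₀).Path) (Cyl n x) = 1)
    (hν : ∀ n, (ν : Measure (G.pascalization v₀).Path) (Cyl n x) = 1) : μ = ν := by
  have key : ∀ {ν : ProbabilityMeasure (G.pascalization v₀).Path} {n y},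
      (ν : Measure (G.pascalization v₀).Path) (Cyl n x) = 1 → Disjoint (Cyl n y) (Cyl n x) →
      (ν : Measure (G.pascalization v₀).Path) (Cyl n y) = 0 := fun {ν n y} h1 h2 =>
    measure_mono_null (Set.subset_compl_iff_disjoint_right.2 h2)
      ((prob_compl_eq_zero_iff (measurableSet_cyl n x)).2 h1)
  refine ProbabilityMeasure.toMeasure_injective (measure_ext_cyl hG 0 fun n _ y => ?_)
  rcases cyl_eq_or_disjoint n y x with h | h
  · rw [h, hμ, hν]
  · rw [key (hμ n) h, key (hν n) h]

theorem exists_measure_pos_ne_zero (n : ℕ) :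
    ∃ v : V, (μ : Measure (G.pascalization v₀).Path) {y | pos y n ∈ ({v} : Set V)} ≠ 0 := by
  by_contra! hcon
  have : (μ : Measure (G.pascalization v₀).Path) Set.univ = 0 :=
    measure_null_of_locally_null _ fun x _ => ⟨_, mem_nhdsWithin_of_mem_nhds
      ((isClopen_pos n {pos x n}).2.mem_nhds rfl), hcon (pos x n)⟩
  simp at this

/-- Vanishing of the two-step factor kills every non-geodesic segment. For a geodesic path the
position at time `k` can be recovered from its tail, so ergodicity makes it deterministic. -/
theorem isLambda_one_of_segMass_two_eq_zero (hT : G.IsTree) {q : ℕ}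
    (hreg : G.IsRegularOfDegree (q + 1)) (hq : q ≠ 0)
    (h : IsInv (μ : Measure (G.pascalization v₀).Path)) (herg : GradedGraph.IsErgodic μ)
    (hc : segMass (μ : Measure (G.pascalization v₀).Path) 2 v₀ = 0) :
    ∃ ω : G.TreeBoundary v₀, IsLambda q ω 1 μ := by
  have hG := hreg.exists_adj
  set m : Measure (G.pascalization v₀).Path := (μ : Measure (G.pascalization v₀).Path) with hm
  have hgeo : ∀ᵐ x ∂m, ∀ n, G.dist v₀ (pos x n) = n := by
    refine measure_null_of_locally_null _ fun x hx => ?_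
    have hx' : ¬ ∀ n, G.dist v₀ (pos x n) = n := hx
    push Not at hx'
    obtain ⟨n, hn⟩ := hx'
    refine ⟨Cyl n x, mem_nhdsWithin_of_mem_nhds ((isClopen_cyl n x).2.mem_nhds (self_mem_cyl n x)),
      ?_⟩
    obtain ⟨k, hk⟩ := dist_pos_parity hT x n
    cases k with
    | zero => exact absurd hk.symm hn
    | succ k =>
      have e1 : segMass m n (pos x n) = 0 := by
        have := h.segMass_add_two hG herg ((occurs_dist (v₀ := v₀) hT hG (pos x n)).add_two_mul hG k)
        rw [hc, zero_mul, show G.dist v₀ (pos x n) + 2 * k + 2 = n by omega] at this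
        exact this
      rw [h.segMass_pos] at e1
      exact (measureReal_eq_zero_iff).1 e1
  have hdet : ∀ k, ∃ v, ∀ᵐ x ∂m, pos x k = v := by
    intro k
    obtain ⟨v, hv⟩ := exists_measure_pos_ne_zero (μ := μ) k
    refine ⟨v, ?_⟩
    -- The tail event that `v` eventually lies on the geodesic from `v₀` to the current position, at
    -- distance `k` from `v₀`; it agrees with `pos x k = v` almost surely.
    set A : Set (G.pascalization v₀).Path :=
      {y | ∃ N, ∀ n, N ≤ n → pos y n ∈ {u | k + G.dist v u = G.dist v₀ u}} with hA
    have hAm : MeasurableSet A := by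
      have : A = ⋃ N : ℕ, ⋂ n : ℕ, ⋂ _ : N ≤ n,
          {y : (G.pascalization v₀).Path | pos y n ∈ {u | k + G.dist v u = G.dist v₀ u}} := by
        ext y
        simp only [hA, Set.mem_iUnion, Set.mem_iInter]
        exact Iff.rfl
      rw [this]
      exact MeasurableSet.iUnion fun N => MeasurableSet.iInter fun n =>
        MeasurableSet.iInter fun _ => measurableSet_pos n _
    have hAt : MeasurableSet[⨅ n, (G.pascalization v₀).tailAlgebra n] A := by
      refine MeasurableSpace.measurableSet_iInf.2 fun j => ⟨hAm, ?_⟩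
      rintro y z hyz ⟨N, hN⟩
      refine ⟨max N j, fun n hn => ?_⟩
      have : pos z n = pos y n :=
        congrArg (fun v => G.pascalizationVertex v) (hyz n ((le_max_right _ _).trans hn)).symm
      rw [this]
      exact hN n ((le_max_left _ _).trans hn)
    have hvk : G.dist v₀ v = k := by
      by_contra hne
      refine hv (measure_eq_zero_iff_ae_notMem.2 (hgeo.mono fun y hgy hy => hne ?_))
      have hy' : pos y k = v := hy
      rw [← hy']
      exact hgy k
    have hiff : ∀ᵐ x ∂m, (pos x k = v ↔ x ∈ A) := by
      filter_upwards [hgeo] with x hx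
      have hdist : ∀ n, k ≤ n → k + G.dist (pos x k) (pos x n) = G.dist v₀ (pos x n) := by
        intro n hn
        have hup : ∀ j, G.dist (pos x k) (pos x (k + j)) ≤ j := by
          intro j
          induction j with
          | zero => simp
          | succ j ih =>
            have := hT.dist_eq_dist_add_one_of_adj (pos x k) (pos_adj x (k + j))
            rw [← add_assoc]
            omega
        have h1 := hup (n - k)
        rw [Nat.add_sub_cancel' hn] at h1
        have h2 : G.dist v₀ (pos x n) ≤ G.dist v₀ (pos x k) + G.dist (pos x k) (pos x n) :=
          hT.connected.dist_triangle
        rw [hx, hx] at h2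
        rw [hx]
        omega
      constructor
      · rintro rfl
        exact ⟨k, hdist⟩
      · rintro ⟨N, hN⟩
        have h1 := hdist (max N k) (le_max_right _ _)
        have h2 := hN (max N k) (le_max_left _ _)
        rw [Set.mem_ofPred_eq] at h2
        exact hT.eq_of_dist_add_dist (a := v₀) (b := pos x (max N k)) (by rw [hx k]; exact h1)
          (by rw [hvk]; exact h2) (by rw [hx, hvk])
    rcases herg A hAt with h1 | h1
    · refine absurd ?_ hv
      refine measure_eq_zero_iff_ae_notMem.2 ?_
      filter_upwards [hiff, measure_eq_zero_iff_ae_notMem.1 h1] with x hx hxA hxv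
      exact hxA (hx.1 hxv)
    · filter_upwards [hiff, (mem_ae_iff_prob_eq_one hAm).2 h1] with x hx hxA
      exact hx.2 hxA
  choose f hf using hdet
  obtain ⟨x, hx, hxg⟩ := ((ae_all_iff.2 hf).and hgeo).exists
  have hone : ∀ n, m (Cyl n x) = 1 := fun n => by
    refine (mem_ae_iff_prob_eq_one (measurableSet_cyl n x)).1 ?_
    filter_upwards [ae_all_iff.2 hf] with y hy k _
    rw [hy, hx]
  let ω : G.TreeBoundary v₀ := ⟨pos x, pos_zero x, pos_adj x, fun i j hij => by
    rw [← hxg i, ← hxg j, hij]⟩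
  refine ⟨ω, ?_⟩
  obtain ⟨ν, hν⟩ := hT.exists_isLambda hreg hq ω (r := 1) (by norm_num)
  have : μ = ν := eq_of_measure_cyl_eq_one hG hone fun n => by
    have e := (isLambda_iff hG).1 hν n x
    rw [Finset.prod_eq_one fun k _ =>
      stepProb_of_leadsTowards (hT.leadsTowards_ray ω k)] at e
    rwa [Measure.real, ENNReal.toReal_eq_one_iff] at e
  rw [this]
  exact hν

/-- The masses separate as `s ^ n * ψ v`, and extremality of the measure becomes extremality of the
eigenfunction `ψ`, which is therefore the Martin kernel of an end. -/
theorem exists_isLambda_of_segMass_two_ne_zero (hT : G.IsTree) {q : ℕ}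
    (hreg : G.IsRegularOfDegree (q + 1)) (hq : 2 ≤ q)
    (h : IsInv (μ : Measure (G.pascalization v₀).Path)) (herg : GradedGraph.IsErgodic μ)
    (hc : segMass (μ : Measure (G.pascalization v₀).Path) 2 v₀ ≠ 0) :
    ∃ ω : G.TreeBoundary v₀, ∃ r ∈ Set.Icc (1 / 2 : ℝ) 1, IsLambda q ω r μ := by
  have hG := hreg.exists_adj
  have hq0 : q ≠ 0 := by omega
  have hq2 : (2 : ℝ) ≤ q := by exact_mod_cast hq
  set m : Measure (G.pascalization v₀).Path := (μ : Measure (G.pascalization v₀).Path) with hm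
  set c := segMass m 2 v₀
  have hc0 : 0 < c := (segMass_nonneg 2 v₀).lt_of_ne' hc
  set s := √c
  have hs0 : 0 < s := Real.sqrt_pos.2 hc0
  have hs2 : s ^ 2 = c := Real.sq_sqrt hc0.le
  set l := s⁻¹
  have hl0 : 0 < l := inv_pos.2 hs0
  have hls : l * s = 1 := inv_mul_cancel₀ hs0.ne'
  -- Normalized mass at the earliest occurrence of `v`; by parity all later occurrences are reached
  -- by shifts of two levels.
  set ψ : V → ℝ := fun v => l ^ G.dist v₀ v * segMass m (G.dist v₀ v) v with hψdef
  have hmass : ∀ n v, Occurs G v₀ n v → segMass m n v = s ^ n * ψ v := by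
    rintro n _ ⟨x, rfl⟩
    obtain ⟨k, hk⟩ := dist_pos_parity hT x n
    have hiter : ∀ j, segMass m (G.dist v₀ (pos x n) + 2 * j) (pos x n) =
        s ^ (2 * j) * segMass m (G.dist v₀ (pos x n)) (pos x n) := by
      intro j
      induction j with
      | zero => simp
      | succ j ih =>
        have := h.segMass_add_two hG herg ((occurs_dist (v₀ := v₀) hT hG (pos x n)).add_two_mul hG j)
        rw [show G.dist v₀ (pos x n) + 2 * (j + 1) = G.dist v₀ (pos x n) + 2 * j + 2 by ring, this,
          ih]
        change c * _ = _
        rw [← hs2]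
        ring
    have e := hiter k
    rw [← hk] at e
    rw [e, hψdef]
    have e2 : s ^ n = s ^ (2 * k) * s ^ G.dist v₀ (pos x n) := by
      rw [← pow_add]; congr 1; omega
    have e3 : s ^ G.dist v₀ (pos x n) * l ^ G.dist v₀ (pos x n) = 1 := by
      rw [← mul_pow, mul_comm, hls, one_pow]
    rw [e2]
    linear_combination -s ^ (2 * k) * segMass m (G.dist v₀ (pos x n)) (pos x n) * e3
  have hψ0 : ψ v₀ = 1 := by
    simp only [hψdef, dist_self, pow_zero, one_mul]
    exact h.segMass_zero hG
  have hψ : ∀ v, ∑ w ∈ G.neighborFinset v, ψ w = l * ψ v := by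
    intro v
    have hv := occurs_dist (v₀ := v₀) hT hG v
    have e1 : segMass m (G.dist v₀ v) v =
        ∑ w ∈ G.neighborFinset v, s ^ (G.dist v₀ v + 1) * ψ w := by
      obtain ⟨x, hx⟩ := hv
      have := h.isHarm hG x (G.dist v₀ v)
      rw [hx] at this
      rw [this]
      exact Finset.sum_congr rfl fun w hw =>
        hmass _ w ((show Occurs G v₀ (G.dist v₀ v) v from ⟨x, hx⟩).succ hG (by simpa using hw))
    rw [hmass _ v hv, ← Finset.mul_sum, pow_succ, mul_assoc] at e1
    have e2 := mul_left_cancel₀ (pow_pos hs0 _).ne' e1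
    rw [e2, ← mul_assoc, hls, one_mul]
  have hpos : ∀ v, 0 < ψ v := eigenfunction_pos hT.connected
    (fun v => mul_nonneg (pow_nonneg hl0.le _) (segMass_nonneg _ _)) hψ (by rw [hψ0]; exact one_pos)
  obtain ⟨F, hF0, hF, hF2, hle⟩ := hreg.exists_harnack hq0 v₀ hpos hψ
  have hF1 : F < 1 := by nlinarith
  have hext : ∀ ψ' : V → ℝ, (∀ v, 0 ≤ ψ' v) → (∀ v, ψ' v ≤ ψ v) →
      (∀ v, ∑ w ∈ G.neighborFinset v, ψ' w = l * ψ' v) → ∃ t, ∀ v, ψ' v = t * ψ v := by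
    intro ψ' h0 h1 h2
    refine ⟨ψ' v₀, fun v => ?_⟩
    obtain ⟨x, hx⟩ := occurs_dist (v₀ := v₀) hT hG v
    -- Multiplying an eigenfunction by `s ^ n` makes it harmonic on the dynamic graph, because `l *
    -- s = 1`.
    have e := h.eq_mul_segMass hG herg (g := fun n v => s ^ n * ψ' v) (fun y k => by
      rw [← Finset.mul_sum, h2, pow_succ]
      linear_combination -s ^ k * ψ' (pos y k) * hls)
      (fun y k => mul_nonneg (pow_nonneg hs0.le k) (h0 _)) (fun y k => by
      rw [hmass k _ (occurs_pos y k)]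
      exact mul_le_mul_of_nonneg_left (h1 _) (pow_nonneg hs0.le k)) x (G.dist v₀ v)
    rw [hx, hmass _ v ⟨x, hx⟩] at e
    simp only [pow_zero, one_mul] at e
    refine mul_left_cancel₀ (pow_pos hs0 (G.dist v₀ v)).ne' ?_
    rw [e]
    ring
  have hedge : ∀ a b, G.Adj a b → ψ b = F * ψ a ∨ ψ a = F * ψ b := fun a b hab =>
    hT.eigenfunction_edge hreg hF0 hF1 hF hψ hle hext hab
  obtain ⟨ω, hω⟩ := hT.exists_treeBoundary_of_edge hreg hF0 hF1 hF hpos hψ hle hedge v₀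
  have hsF : s * (q * F ^ 2 + 1) = F := by rw [hF, ← mul_assoc, mul_comm s, hls, one_mul]
  have hqF : 0 ≤ q * F ^ 2 := by positivity
  -- A step towards `ω` multiplies the mass by `s / F`, any other by `s * F`. The root equation
  -- gives `s / F = 1 / (1 + q F²)`, and `0 ≤ q F² ≤ 1` places this in `[1/2, 1]`.
  refine ⟨ω, s / F, ⟨?_, ?_⟩, (isLambda_iff hG).2 fun n x => ?_⟩
  · rw [div_le_div_iff₀ two_pos hF0]
    nlinarith
  · rw [div_le_one hF0]
    nlinarith
  · have hB : (1 - s / F) / q = s * F := by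
      have : (q : ℝ) ≠ 0 := by positivity
      field_simp
      linarith
    rw [← h.segMass_pos]
    induction n with
    | zero =>
      rw [pos_zero, Finset.prod_range_zero]
      exact h.segMass_zero hG
    | succ n ih =>
      rw [Finset.prod_range_succ, ← ih, hmass n _ (occurs_pos x n),
        hmass (n + 1) _ (occurs_pos x (n + 1))]
      obtain ⟨h1, h2⟩ := hω _ _ (pos_adj x n)
      by_cases hl : LeadsTowards ω (pos x n) (pos x (n + 1))
      · rw [stepProb_of_leadsTowards hl, h1 hl]
        field_simp
        ring
      · rw [stepProb_of_not_leadsTowards hl, h2 hl, hB]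
        ring

theorem exists_isLambda_of_mem_erg (hT : G.IsTree) {q : ℕ}
    (hreg : G.IsRegularOfDegree (q + 1)) (hq : 2 ≤ q) (hμ : μ ∈ (G.pascalization v₀).erg) :
    ∃ ω : G.TreeBoundary v₀, ∃ r ∈ Set.Icc (1 / 2 : ℝ) 1, IsLambda q ω r μ := by
  have h := isInv_of_isCentral hμ.1
  by_cases hc : segMass (μ : Measure (G.pascalization v₀).Path) 2 v₀ = 0
  · obtain ⟨ω, hω⟩ := isLambda_one_of_segMass_two_eq_zero hT hreg (by omega) h hμ.2 hc
    exact ⟨ω, 1, by norm_num, hω⟩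
  · exact exists_isLambda_of_segMass_two_ne_zero hT hreg hq h hμ.2 hc

end Central

end SimpleGraph

/-! ### Uniqueness of the parameters and the theorem. -/

namespace SimpleGraph

variable {V : Type u} {G : SimpleGraph V} {v₀ : V} [G.LocallyFinite] {q : ℕ}
  {ω ω' : G.TreeBoundary v₀} {r r' : ℝ} {μ : ProbabilityMeasure (G.pascalization v₀).Path}

theorem IsLambda.stepProb_eq (hT : G.IsTree) (hG : ∀ v, ∃ w, G.Adj v w) (h : IsLambda q ω r μ)
    (h' : IsLambda q ω' r' μ) {n : ℕ} {v w : V} (hv : Occurs G v₀ n v) (hw : G.Adj v w)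
    (hne : segMass (μ : Measure (G.pascalization v₀).Path) n v ≠ 0) :
    stepProb q ω r v w = stepProb q ω' r' v w :=
  mul_left_cancel₀ hne (by rw [← h.segMass_succ hT hG hv hw, ← h'.segMass_succ hT hG hv hw])

/-- The parameter `r` is determined by the law of the first step. -/
theorem IsLambda.param_eq (hT : G.IsTree) (hreg : G.IsRegularOfDegree (q + 1)) (hq : 2 ≤ q)
    (h : IsLambda q ω r μ) (h' : IsLambda q ω' r' μ) : r = r' := by
  have hG := hreg.exists_adj
  have hstep : ∀ w, G.Adj v₀ w → stepProb q ω r v₀ w = stepProb q ω' r' v₀ w := fun w hw =>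
    h.stepProb_eq hT hG h' (occurs_zero hG) hw
      (by rw [(h.isInv hT hG).segMass_zero hG]; exact one_ne_zero)
  obtain ⟨w, hw, hl⟩ := hT.exists_leadsTowards ω v₀
  obtain ⟨w', hw', hl'⟩ := hT.exists_leadsTowards ω' v₀
  -- Degree at least three leaves a neighbour towards neither end, so its transition probability
  -- reveals `r` and `r'` directly.
  obtain ⟨u, hu, huw, huw'⟩ := hreg.exists_adj_ne_ne hq v₀ w w'
  have e := hstep u hu
  rw [stepProb_of_not_leadsTowards fun hlu => huw (hT.leadsTowards_unique hu hw hlu hl),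
    stepProb_of_not_leadsTowards fun hlu => huw' (hT.leadsTowards_unique hu hw' hlu hl')] at e
  have hq' : (q : ℝ) ≠ 0 := Nat.cast_ne_zero.2 (by omega)
  linarith [(div_left_inj' hq').1 e]

/-- Every initial segment of `ω` has positive mass, so the transition probabilities along it are
determined. If the rays separated, then `r = (1 - r) / q`, impossible for `r ≥ 1/2`; at `r = 1/(q +
1)` the end would indeed be lost. -/
theorem IsLambda.boundary_eq (hT : G.IsTree) (hreg : G.IsRegularOfDegree (q + 1)) (hq : 2 ≤ q)
    (hr : 1 / 2 ≤ r) (h : IsLambda q ω r μ) (h' : IsLambda q ω' r μ) : ω = ω' := by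
  have hG := hreg.exists_adj
  have hq' : (2 : ℝ) ≤ q := by exact_mod_cast hq
  let x : (G.pascalization v₀).Path := mkPath ω.1 ω.2.1 ω.2.2.1
  have hne : ∀ n, segMass (μ : Measure (G.pascalization v₀).Path) n (ω.1 n) ≠ 0 := by
    intro n
    have e := (h.isInv hT hG).segMass_pos n x
    rw [show pos x n = ω.1 n from rfl] at e
    rw [e, (isLambda_iff hG).1 h]
    refine Finset.prod_ne_zero_iff.2 fun k _ => ?_
    rw [show pos x k = ω.1 k from rfl, show pos x (k + 1) = ω.1 (k + 1) from rfl,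
      stepProb_of_leadsTowards (hT.leadsTowards_ray ω k)]
    linarith
  refine TreeBoundary.ext fun n => ?_
  induction n with
  | zero => rw [ω.2.1, ω'.2.1]
  | succ n ih =>
    have e := h.stepProb_eq hT hG h' (n := n) (v := ω.1 n) ⟨x, rfl⟩ (ω.2.2.1 n) (hne n)
    rw [stepProb_of_leadsTowards (hT.leadsTowards_ray ω n)] at e
    by_cases hl : LeadsTowards ω' (ω.1 n) (ω.1 (n + 1))
    · have h1 := hT.leadsTowards_ray ω' n
      have h2 := ω'.2.2.1 n
      rw [← ih] at h1 h2
      exact hT.leadsTowards_unique (ω.2.2.1 n) h2 hl h1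
    · rw [stepProb_of_not_leadsTowards hl, eq_div_iff (by positivity)] at e
      nlinarith

end SimpleGraph

theorem theorem15 {V : Type*} (G : SimpleGraph V) [G.LocallyFinite] (q : ℕ) (hq : 2 ≤ q)
    (hT : G.IsTree) (hreg : G.IsRegularOfDegree (q + 1)) (v₀ : V) :
    ∃ lam : G.TreeBoundary v₀ → ℝ → ProbabilityMeasure (G.pascalization v₀).Path,
      -- for all `ω` and all `r ∈ [0, 1]`, the measure `λ_{ω,r}` exists, is unique, and is `lam ω r`
      (∀ (ω : G.TreeBoundary v₀), ∀ r ∈ Set.Icc (0 : ℝ) 1,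
        ∀ μ : ProbabilityMeasure (G.pascalization v₀).Path,
          SimpleGraph.IsLambda q ω r μ ↔ μ = lam ω r) ∧
      -- the ergodic central measures are exactly the measures `λ_{ω,r}` with `r ∈ [1/2, 1]`
      (G.pascalization v₀).erg = {μ | ∃ ω, ∃ r ∈ Set.Icc (1 / 2 : ℝ) 1, μ = lam ω r} ∧
      -- `(ω, r) ↦ λ_{ω,r}` is a homeomorphism of `∂T × [1/2, 1]` onto the absolute boundary
      (∃ e : G.TreeBoundary v₀ × Set.Icc (1 / 2 : ℝ) 1 ≃ₜ (G.pascalization v₀).erg,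
        ∀ (ω : G.TreeBoundary v₀) (r : Set.Icc (1 / 2 : ℝ) 1),
          (e (ω, r) : ProbabilityMeasure (G.pascalization v₀).Path) = lam ω r) ∧
      -- loss of ergodicity for `r < 1/2`
      (∀ (ω : G.TreeBoundary v₀), ∀ r ∈ Set.Ico (0 : ℝ) (1 / 2),
        GradedGraph.IsCentral (lam ω r) ∧ ¬ GradedGraph.IsErgodic (lam ω r)) := by
  have hG := hreg.exists_adj
  have hq0 : q ≠ 0 := by omega
  have hex : ∀ (ω : G.TreeBoundary v₀) (r : ℝ), ∃ μ : ProbabilityMeasure (G.pascalization v₀).Path,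
      r ∈ Set.Icc (0 : ℝ) 1 → SimpleGraph.IsLambda q ω r μ := by
    intro ω r
    by_cases hr : r ∈ Set.Icc (0 : ℝ) 1
    · obtain ⟨μ, hμ⟩ := hT.exists_isLambda hreg hq0 ω hr
      exact ⟨μ, fun _ => hμ⟩
    -- An arbitrary value for parameters outside `[0, 1]`.
    · obtain ⟨μ, -⟩ := hT.exists_isLambda hreg hq0 ω (r := 1) (by norm_num)
      exact ⟨μ, fun h => absurd h hr⟩
  choose lam hlam using hex
  have hsub : ∀ r ∈ Set.Icc (1 / 2 : ℝ) 1, r ∈ Set.Icc (0 : ℝ) 1 := fun r hr =>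
    ⟨by linarith [hr.1], hr.2⟩
  have hmem : ∀ (ω : G.TreeBoundary v₀), ∀ r ∈ Set.Icc (1 / 2 : ℝ) 1,
      lam ω r ∈ (G.pascalization v₀).erg := fun ω r hr =>
    ⟨((hlam ω r (hsub r hr)).isInv hT hG).isCentral hG,
      (hlam ω r (hsub r hr)).isErgodic hT hreg hq0 hr⟩
  have hsurj : ∀ μ ∈ (G.pascalization v₀).erg, ∃ ω, ∃ r ∈ Set.Icc (1 / 2 : ℝ) 1, μ = lam ω r := by
    intro μ hμ
    obtain ⟨ω, r, hr, h⟩ := SimpleGraph.exists_isLambda_of_mem_erg hT hreg hq hμ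
    exact ⟨ω, r, hr, h.unique hG (hlam ω r (hsub r hr))⟩
  refine ⟨lam, fun ω r hr μ => ⟨fun h => h.unique hG (hlam ω r hr), fun h => h ▸ hlam ω r hr⟩,
    Set.Subset.antisymm hsurj ?_, ?_, fun ω r hr => ?_⟩
  · rintro _ ⟨ω, r, hr, rfl⟩
    exact hmem ω r hr
  · let Φ (p : G.TreeBoundary v₀ × Set.Icc (1 / 2 : ℝ) 1) : (G.pascalization v₀).erg :=
      ⟨lam p.1 p.2, hmem p.1 p.2 p.2.2⟩
    have hcont : Continuous Φ := Continuous.subtype_mk (SimpleGraph.continuous_of_isLambda hT hG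
      (p := fun p : G.TreeBoundary v₀ × Set.Icc (1 / 2 : ℝ) 1 => (p.1, (p.2 : ℝ)))
      (by fun_prop) fun p => hlam p.1 p.2 (hsub _ p.2.2)) _
    have hbij : Function.Bijective Φ := by
      constructor
      · rintro ⟨ω, r⟩ ⟨ω', r'⟩ h
        have h1 := hlam ω r (hsub _ r.2)
        have h2 := hlam ω' r' (hsub _ r'.2)
        rw [← show lam ω r = lam ω' r' from congrArg Subtype.val h] at h2
        obtain rfl : r = r' := Subtype.ext (h1.param_eq hT hreg hq h2)
        rw [h1.boundary_eq hT hreg hq r.2.1 h2]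
      · rintro ⟨μ, hμ⟩
        obtain ⟨ω, r, hr, rfl⟩ := hsurj μ hμ
        exact ⟨(ω, ⟨r, hr⟩), rfl⟩
    exact ⟨Continuous.homeoOfEquivCompactToT2 (f := Equiv.ofBijective Φ hbij) hcont,
      fun _ _ => rfl⟩
  · have h := hlam ω r ⟨hr.1, by linarith [hr.2]⟩
    have hcentral := (h.isInv hT hG).isCentral hG
    refine ⟨hcentral, fun herg => ?_⟩
    -- Were the measure ergodic, it would also have a parameter `r' ≥ 1/2`, contradicting the
    -- uniqueness of `r`.
    obtain ⟨ω', r', hr', h'⟩ := SimpleGraph.exists_isLambda_of_mem_erg hT hreg hq ⟨hcentral, herg⟩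
    have := h.param_eq hT hreg hq h'
    linarith [hr.2, hr'.1]
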